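/- Let $C_k$ denote the cycle of length $k$, and let $C_m[n]$ denote the lexicographic product of $C_m$ with the empty graph on $n$ points: its point set is $V(C_m)\times\mathbb{Z}_n$, and $(x,i)$ and $(y,j)$ are joined if and only if $xy\in E(C_m)$. A $C_k$-factor of a graph $G$ is a spanning subgraph of $G$ each of whose connected components is a cycle of length $k$. For a graph $G$, let $\mathrm{HWP}(G;m,n)$ be the set of pairs $(\alpha,\beta)$ of non-negative integers such that the edge set of $G$ can be partitioned into the edge sets of $\alpha$ $C_m$-factors and $\beta$ $C_n$-factors of $G$. **Theorem.** Let $m$ and $n$ be odd integers with $n\ge m\ge 3$, and let $\alpha,\beta\geq 0$ be integers with $\alpha\le n$. If $(\alpha,\beta)\in\mathrm{HWP}(C_m[n];m,n)$, then $\beta=n-\alpha$. Conversely, if $\beta=n-\alpha$, then $(\alpha,\beta)\in\mathrm{HWP}(C_m[n];m,n)$, except possibly when $\alpha\in\{2,4\}$, or $\beta\in\{1,3\}$, or $(m,n,\alpha)\in\{(3,11,6),(3,13,8),(3,15,8)\}$. -/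

import Mathlib

/-- The lexicographic product `G[n]` of a graph `G` with the empty graph on `n` points:
the point set is `V(G) × ℤ_n`, and `(x, i)` and `(y, j)` are joined if and only if
`x` and `y` are joined in `G`. -/
def lexEmpty {V : Type*} (G : SimpleGraph V) (n : ℕ) : SimpleGraph (V × ZMod n) where
  Adj p q := G.Adj p.1 q.1
  symm := ⟨fun _ _ h => h.symm⟩
  loopless := ⟨fun p h => G.loopless.irrefl p.1 h⟩

/-- `F` is a `C_k`-factor of `G`: a spanning subgraph of `G` (same vertex set, edges among those
of `G`) each of whose connected components is a cycle of length `k`. -/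
def IsCycleFactor {V : Type*} (G F : SimpleGraph V) (k : ℕ) : Prop :=
  F ≤ G ∧ ∀ c : F.ConnectedComponent, Nonempty (c.toSimpleGraph ≃g SimpleGraph.cycleGraph k)

/-- A solution to `HW(G; m, n; α, β)`: a list of `α` `C_m`-factors and `β` `C_n`-factors of `G`
that are pairwise edge-disjoint and between them contain every edge of `G`. -/
structure IsHWSolution {V : Type*} (G : SimpleGraph V) (m n α β : ℕ)
    (F : Fin α ⊕ Fin β → SimpleGraph V) : Prop where
  left_factor : ∀ i : Fin α, IsCycleFactor G (F (Sum.inl i)) m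
  right_factor : ∀ j : Fin β, IsCycleFactor G (F (Sum.inr j)) n
  edge_disjoint : ∀ s t, s ≠ t → Disjoint (F s).edgeSet (F t).edgeSet
  edge_cover : ⋃ s, (F s).edgeSet = G.edgeSet

/-- `HWP(G; m, n)`: the set of pairs `(α, β)` of non-negative integers for which a solution
to `HW(G; m, n; α, β)` exists. -/
def HWP {V : Type*} (G : SimpleGraph V) (m n : ℕ) : Set (ℕ × ℕ) :=
  {p | ∃ F : Fin p.1 ⊕ Fin p.2 → SimpleGraph V, IsHWSolution G m n p.1 p.2 F}

/-! View `C_m[n]` as a cyclic stack of m layers, each a copy of `ZMod n`. Every edge is an arc from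
some (x, i) to (x + 1, j) and has a difference j - i. It suffices to split `ZMod n` into D and its
complement so that the arcs with difference in D decompose into C_m-factors and the others into
C_n-factors (`mem_HWP_of_decomposesInto`).

C_m-factors: a cycle climbing one layer per step closes after m steps when its differences sum to 0.
Hence an array with zero row sums whose m columns each enumerate D is enough
(`decomposesInto_of_array`). By Hall's theorem (`exists_columns`) only the rows matter, provided
together they use each element of D equally often; short odd rows are lengthened by cancelling
pairs, so zero-sum triples usually suffice.

C_n-factors: follow a Hamiltonian cycle of `ZMod n`, moving up or down a layer at each step. With (n
+ m)/2 ups the height changes by m, so the walk closes after n steps and its m shifted copies form a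
factor. Exchanging ups and downs gives a second factor, which uses each edge in the other direction
(`decomposesInto_of_hamiltonian`). So a unit a yields 2 factors from ±a, and coprime a, b yield 4
from ±a, ±b, since that circulant graph splits into two Hamiltonian cycles
(`exists_hamiltonian_split`). The difference 0 lies on no Hamiltonian cycle; it is handled inside a
block {0, ±1, ±2} or {0, ±2, ±4} giving five factors (`decomposesInto_five`).

For odd α the set D is an interval [-k, k]. For even α the difference 0 goes to the C_n side, which
costs β ≥ 5. Explicit tables serve 6 ≤ α ≤ 26; for α ≥ 28, D is an interval without {0, ±2, ±4},
covered by triples through one trade uniform in the length. Necessity of α + β = n is a degree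
count. -/

/-! ### Cycle factors of the layered graph and the degree count -/

theorem cycleGraph_adj_zmod {k : ℕ} (s t : ZMod (k + 2)) :
    (SimpleGraph.cycleGraph (k + 2)).Adj (show Fin (k + 2) from s) (show Fin (k + 2) from t) ↔
      t = s + 1 ∨ s = t + 1 := by
  have h : ∀ a b : Fin (k + 2), (SimpleGraph.cycleGraph (k + 2)).Adj a b ↔
      b = a + 1 ∨ a = b + 1 := by
    intro a b
    rw [SimpleGraph.cycleGraph_adj, or_comm, sub_eq_iff_eq_add, sub_eq_iff_eq_add, add_comm 1 a,
      add_comm 1 b]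
  exact h s t

/-- A graph whose vertices are arranged, by a bijection with `K × ZMod k`, into cycles of length
`k` is a `C_k`-factor of every graph containing it. -/
theorem isCycleFactor_of_equiv {V K : Type*} {G F : SimpleGraph V} {k : ℕ} (hk : 3 ≤ k)
    (e : K × ZMod k ≃ V)
    (hF : ∀ c t c' t', F.Adj (e (c, t)) (e (c', t')) ↔ c = c' ∧ (t' = t + 1 ∨ t = t' + 1))
    (hle : F ≤ G) : IsCycleFactor G F k := by
  refine ⟨hle, fun C => ?_⟩
  obtain ⟨k, rfl⟩ : ∃ k', k = k' + 2 := ⟨k - 2, by omega⟩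
  have hfst : ∀ p q, F.Reachable p q → (e.symm p).1 = (e.symm q).1 := by
    rintro p q ⟨w⟩
    induction w with
    | nil => rfl
    | @cons a b c h _ ih =>
      rw [← ih]
      obtain ⟨⟨a1, a2⟩, rfl⟩ := e.surjective a
      obtain ⟨⟨b1, b2⟩, rfl⟩ := e.surjective b
      simpa using ((hF _ _ _ _).1 h).1
  have hreach : ∀ c t, F.Reachable (e (c, 0)) (e (c, t)) := by
    intro c t
    obtain ⟨j, rfl⟩ := ZMod.natCast_zmod_surjective t
    induction j with
    | zero => simp
    | succ j ih =>
      refine ih.trans (SimpleGraph.Adj.reachable ((hF _ _ _ _).2 ⟨rfl, Or.inl ?_⟩))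
      push_cast; rfl
  induction C using SimpleGraph.ConnectedComponent.ind with
  | h v =>
  obtain ⟨⟨c, t₀⟩, rfl⟩ := e.surjective v
  have hmem : ∀ t, e (c, t) ∈ F.connectedComponentMk (e (c, t₀)) := fun t =>
    SimpleGraph.ConnectedComponent.sound ((hreach c t).symm.trans (hreach c t₀))
  refine ⟨SimpleGraph.Iso.symm
    ⟨⟨fun t => ⟨e (c, t), hmem t⟩, fun p => (e.symm p.1).2, ?_, ?_⟩, ?_⟩⟩
  · intro t
    simp
  · rintro ⟨p, hp⟩
    have h1 := hfst _ _ (SimpleGraph.ConnectedComponent.exact hp)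
    obtain ⟨⟨a1, a2⟩, rfl⟩ := e.surjective p
    simp only [Equiv.symm_apply_apply] at h1
    simp [h1]
  · intro s t
    exact (hF c s c t).trans ((and_iff_right rfl).trans (cycleGraph_adj_zmod s t).symm)

/-- The graph on `ZMod m × ZMod n` in which `(x, i)` is joined to `(x + 1, j)` whenever
`A x i j`. -/
def arcGraph {m n : ℕ} (A : ZMod m → ZMod n → ZMod n → Prop) :
    SimpleGraph (ZMod m × ZMod n) :=
  SimpleGraph.fromRel fun p q => q.1 = p.1 + 1 ∧ A p.1 p.2 q.2

theorem arcGraph_adj {m n : ℕ} (hm : 2 ≤ m) {A : ZMod m → ZMod n → ZMod n → Prop}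
    {p q : ZMod m × ZMod n} : (arcGraph A).Adj p q ↔
      (q.1 = p.1 + 1 ∧ A p.1 p.2 q.2) ∨ (p.1 = q.1 + 1 ∧ A q.1 q.2 p.2) := by
  have : Fact (1 < m) := ⟨hm⟩
  rw [arcGraph, SimpleGraph.fromRel_adj, and_iff_right_iff_imp]
  rintro (⟨h, -⟩ | ⟨h, -⟩) rfl <;> simp at h

/-- The arcs whose difference lies in `D` fall into `r` classes, each forming a `C_k`-factor. -/
def DecomposesInto (m n k : ℕ) (D : Set (ZMod n)) (r : ℕ) : Prop :=
  ∃ A : Fin r → ZMod m → ZMod n → ZMod n → Prop,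
    (∀ s, IsCycleFactor (arcGraph fun _ _ _ => True) (arcGraph (A s)) k) ∧
    (∀ x i j, j - i ∈ D → ∃! s, A s x i j) ∧ ∀ s x i j, A s x i j → j - i ∈ D

theorem DecomposesInto.union {m n k r r' : ℕ} {D D' : Set (ZMod n)}
    (h : DecomposesInto m n k D r) (h' : DecomposesInto m n k D' r') (hd : Disjoint D D') :
    DecomposesInto m n k (D ∪ D') (r + r') := by
  obtain ⟨A, hA, hu, hD⟩ := h
  obtain ⟨A', hA', hu', hD'⟩ := h'
  refine ⟨fun s => Sum.elim A A' (finSumFinEquiv.symm s), fun s => ?_, fun x i j hij => ?_,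
    fun s x i j hs => ?_⟩
  · rcases h : finSumFinEquiv.symm s with t | t <;> simp only [h]
    exacts [hA t, hA' t]
  · rw [← finSumFinEquiv.existsUnique_congr_right]
    simp only [Equiv.symm_apply_apply]
    rcases hij with hij | hij
    · obtain ⟨s, hs, hs'⟩ := hu x i j hij
      refine ⟨Sum.inl s, hs, ?_⟩
      rintro (t | t) ht
      · rw [hs' t ht]
      · exact absurd (hD' _ _ _ _ ht) (Set.disjoint_left.1 hd hij)
    · obtain ⟨s, hs, hs'⟩ := hu' x i j hij
      refine ⟨Sum.inr s, hs, ?_⟩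
      rintro (t | t) ht
      · exact absurd hij (Set.disjoint_left.1 hd (hD _ _ _ _ ht))
      · rw [hs' t ht]
  · rcases h : finSumFinEquiv.symm s with t | t <;> simp only [h, Sum.elim_inl, Sum.elim_inr] at hs
    · exact Or.inl (hD _ _ _ _ hs)
    · exact Or.inr (hD' _ _ _ _ hs)

theorem decomposesInto_empty (m n k : ℕ) : DecomposesInto m n k ∅ 0 :=
  ⟨fun s => s.elim0, fun s => s.elim0, fun _ _ _ h => h.elim, fun s => s.elim0⟩

/-- A partition of all arcs into classes forming factors is a Hamilton–Waterloo solution. -/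
theorem isHWSolution_of_arcs {m n k l α β : ℕ} (hm : 3 ≤ m)
    (A : Fin α ⊕ Fin β → ZMod m → ZMod n → ZMod n → Prop)
    (hl : ∀ s, IsCycleFactor (arcGraph fun _ _ _ => True) (arcGraph (A (Sum.inl s))) k)
    (hr : ∀ s, IsCycleFactor (arcGraph fun _ _ _ => True) (arcGraph (A (Sum.inr s))) l)
    (hu : ∀ x i j, ∃! s, A s x i j) :
    (α, β) ∈ HWP (lexEmpty (SimpleGraph.cycleGraph m) n) k l := by
  obtain ⟨m, rfl⟩ : ∃ m', m = m' + 2 := ⟨m - 2, by omega⟩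
  have hG : (arcGraph (m := m + 2) (n := n) fun _ _ _ => True) =
      lexEmpty (SimpleGraph.cycleGraph (m + 2)) n := by
    ext p q
    rw [arcGraph_adj (by omega), and_true, and_true]
    exact (cycleGraph_adj_zmod p.1 q.1).symm
  suffices h : (α, β) ∈ HWP (arcGraph (m := m + 2) (n := n) fun _ _ _ => True) k l from
    hG ▸ h
  -- With at least three layers an edge is an upward arc from only one of its ends, so classes of
  -- arcs and sets of edges correspond.
  have h2 : ∀ a b : ZMod (m + 2), a = b + 1 → b = a + 1 → False := by
    intro a b h h'
    have h3 : ((2 : ℕ) : ZMod (m + 2)) = 0 := by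
      rw [h] at h'
      push_cast
      linear_combination -h'
    rw [ZMod.natCast_eq_zero_iff] at h3
    have := Nat.le_of_dvd (by omega) h3
    omega
  refine ⟨fun s => arcGraph (A s), hl, hr, ?_, ?_⟩
  · intro s t hst
    rw [Set.disjoint_left]
    intro e hs ht
    induction e with
    | h p q =>
    rw [SimpleGraph.mem_edgeSet, arcGraph_adj (by omega)] at hs ht
    rcases hs with ⟨h1, hs⟩ | ⟨h1, hs⟩ <;> rcases ht with ⟨h3, ht⟩ | ⟨h3, ht⟩
    · exact hst ((hu _ _ _).unique hs ht)
    · exact h2 _ _ h1 h3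
    · exact h2 _ _ h1 h3
    · exact hst ((hu _ _ _).unique hs ht)
  · ext e
    induction e with
    | h p q =>
    simp only [Set.mem_iUnion, SimpleGraph.mem_edgeSet,
      arcGraph_adj (show 2 ≤ m + 2 by omega), and_true]
    constructor
    · rintro ⟨s, h | h⟩
      exacts [Or.inl h.1, Or.inr h.1]
    · rintro (h | h)
      · obtain ⟨s, hs, -⟩ := hu p.1 p.2 q.2
        exact ⟨s, Or.inl ⟨h, hs⟩⟩
      · obtain ⟨s, hs, -⟩ := hu q.1 q.2 p.2
        exact ⟨s, Or.inr ⟨h, hs⟩⟩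

theorem mem_HWP_of_decomposesInto {m n k l α β : ℕ} (hm : 3 ≤ m) {D : Set (ZMod n)}
    (h : DecomposesInto m n k D α) (h' : DecomposesInto m n l Dᶜ β) :
    (α, β) ∈ HWP (lexEmpty (SimpleGraph.cycleGraph m) n) k l := by
  obtain ⟨A, hA, hu, hD⟩ := h
  obtain ⟨A', hA', hu', hD'⟩ := h'
  refine isHWSolution_of_arcs hm (Sum.elim A A') hA hA' fun x i j => ?_
  by_cases hij : j - i ∈ D
  · obtain ⟨s, hs, hs'⟩ := hu x i j hij
    refine ⟨Sum.inl s, hs, ?_⟩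
    rintro (t | t) ht
    · rw [hs' t ht]
    · exact absurd hij (hD' _ _ _ _ ht)
  · obtain ⟨s, hs, hs'⟩ := hu' x i j hij
    refine ⟨Sum.inr s, hs, ?_⟩
    rintro (t | t) ht
    · exact absurd (hD _ _ _ _ ht) hij
    · rw [hs' t ht]

/-- Every vertex of a `C_k`-factor has two neighbours. -/
theorem IsCycleFactor.ncard_neighborSet {V : Type*} {G F : SimpleGraph V} {k : ℕ} (hk : 3 ≤ k)
    (h : IsCycleFactor G F k) (v : V) : (F.neighborSet v).ncard = 2 := by
  obtain ⟨k, rfl⟩ : ∃ k', k = k' + 3 := ⟨k - 3, by omega⟩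
  obtain ⟨φ⟩ := h.2 (F.connectedComponentMk v)
  set v' : (F.connectedComponentMk v) := ⟨v, rfl⟩
  have h1 : ((SimpleGraph.cycleGraph (k + 3)).neighborSet (φ v')).ncard = 2 := by
    rw [← SimpleGraph.coe_neighborFinset, Set.ncard_coe_finset]
    exact SimpleGraph.cycleGraph_degree_three_le
  rw [← h1]
  refine (Set.ncard_congr (fun a _ => ((φ.symm a : F.connectedComponentMk v) : V)) ?_ ?_ ?_)|>.symm
  · intro a ha
    have : (F.connectedComponentMk v).toSimpleGraph.Adj (φ.symm (φ v')) (φ.symm a) :=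
      φ.symm.map_adj_iff.2 ha
    rw [RelIso.symm_apply_apply] at this
    exact this
  · intro a b _ _ hab
    exact φ.symm.injective (Subtype.ext hab)
  · intro w hw
    have hw' : w ∈ F.connectedComponentMk v :=
      SimpleGraph.ConnectedComponent.sound (SimpleGraph.Adj.reachable (SimpleGraph.Adj.symm hw))
    refine ⟨φ ⟨w, hw'⟩, ?_, by simp⟩
    exact φ.map_adj_iff.2 hw

/-- Each vertex has 2n neighbours in `C_m[n]`, and every factor accounts for exactly two of them. -/
theorem eq_sub_of_mem_HWP {m n α β : ℕ} (hm : 3 ≤ m) (hn : 3 ≤ n)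
    (h : (α, β) ∈ HWP (lexEmpty (SimpleGraph.cycleGraph m) n) m n) : α + β = n := by
  obtain ⟨F, hF⟩ := h
  have : NeZero n := ⟨by omega⟩
  obtain ⟨m, rfl⟩ : ∃ m', m = m' + 3 := ⟨m - 3, by omega⟩
  let v : Fin (m + 3) × ZMod n := (0, 0)
  set G := lexEmpty (SimpleGraph.cycleGraph (m + 3)) n
  have h2 : ∀ s, ((F s).neighborSet v).ncard = 2 := by
    rintro (s | s)
    · exact (hF.left_factor s).ncard_neighborSet hm v
    · exact (hF.right_factor s).ncard_neighborSet hn v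
  have hcov : G.neighborSet v = ⋃ s, (F s).neighborSet v := by
    ext w
    have := Set.ext_iff.1 hF.edge_cover s(v, w)
    simpa using this.symm
  have hdis : Pairwise (Function.onFun Disjoint fun s => (F s).neighborSet v) := by
    intro s t hst
    refine Set.disjoint_left.2 fun w hs ht => ?_
    exact Set.disjoint_left.1 (hF.edge_disjoint s t hst) ((F s).mem_edgeSet.2 hs)
      ((F t).mem_edgeSet.2 ht)
  have hG : (G.neighborSet v).ncard = 2 * n := by
    have : G.neighborSet v = ((SimpleGraph.cycleGraph (m + 3)).neighborSet 0) ×ˢ Set.univ := by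
      ext w
      simp [G, lexEmpty, v]
    rw [this, Set.ncard_prod, Set.ncard_univ, Nat.card_zmod]
    congr 1
    rw [← SimpleGraph.coe_neighborFinset, Set.ncard_coe_finset]
    exact SimpleGraph.cycleGraph_degree_three_le
  have hsum : (G.neighborSet v).ncard = ∑ s, ((F s).neighborSet v).ncard := by
    rw [hcov, ← Nat.card_coe_set_eq]
    rw [Nat.card_congr (Set.unionEqSigmaOfDisjoint hdis), Nat.card_sigma]
    rfl
  rw [hG] at hsum
  simp only [h2, Finset.sum_const, Finset.card_univ, Fintype.card_sum, Fintype.card_fin,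
    smul_eq_mul] at hsum
  omega

theorem decomposesInto_of_fintype {m n k : ℕ} {D : Set (ZMod n)} {ι : Type*} [Fintype ι]
    (A : ι → ZMod m → ZMod n → ZMod n → Prop)
    (hA : ∀ s, IsCycleFactor (arcGraph fun _ _ _ => True) (arcGraph (A s)) k)
    (hu : ∀ x i j, j - i ∈ D → ∃! s, A s x i j) (hD : ∀ s x i j, A s x i j → j - i ∈ D) :
    DecomposesInto m n k D (Fintype.card ι) := by
  refine ⟨fun s => A ((Fintype.equivFin ι).symm s), fun s => hA _, fun x i j hij => ?_,
    fun s => hD _⟩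
  rw [← (Fintype.equivFin ι).existsUnique_congr_right]
  simpa using hu x i j hij

/-! ### Climbing cycles and zigzag cycles -/

theorem arcGraph_le_true {m n : ℕ} (hm : 2 ≤ m) (A : ZMod m → ZMod n → ZMod n → Prop) :
    arcGraph A ≤ arcGraph fun _ _ _ => True := by
  intro p q h
  rw [arcGraph_adj hm] at h ⊢
  exact h.imp (fun h => ⟨h.1, trivial⟩) fun h => ⟨h.1, trivial⟩

/-- Cycles that advance one layer at every step. -/
theorem isCycleFactor_of_levels {m n : ℕ} (hm : 3 ≤ m) (g : ZMod m → (ZMod n ≃ ZMod n)) :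
    IsCycleFactor (arcGraph fun _ _ _ => True)
      (arcGraph fun x i j => ∃ k, i = g x k ∧ j = g (x + 1) k) m := by
  let e : ZMod n × ZMod m ≃ ZMod m × ZMod n :=
    ⟨fun p => (p.2, g p.2 p.1), fun q => ((g q.1).symm q.2, q.1),
      fun p => by simp, fun q => by simp⟩
  refine isCycleFactor_of_equiv hm e (fun c t c' t' => ?_) (arcGraph_le_true (by omega) _)
  rw [arcGraph_adj (by omega)]
  change (t' = t + 1 ∧ ∃ k, g t c = g t k ∧ g t' c' = g (t + 1) k) ∨
    (t = t' + 1 ∧ ∃ k, g t' c' = g t' k ∧ g t c = g (t' + 1) k) ↔ _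
  constructor
  · rintro (⟨rfl, k, h, h'⟩ | ⟨rfl, k, h, h'⟩)
    · exact ⟨((g _).injective h).trans ((g _).injective h').symm, Or.inl rfl⟩
    · exact ⟨((g _).injective h').trans ((g _).injective h).symm, Or.inr rfl⟩
  · rintro ⟨rfl, rfl | rfl⟩
    · exact Or.inl ⟨rfl, c, rfl, rfl⟩
    · exact Or.inr ⟨rfl, c, rfl, rfl⟩

/-- The signs `ε` around a cycle of length `n` lift to a closed walk in a cycle of length `m`. -/
def BalancedSigns (m : ℕ) {n : ℕ} (ε : ZMod n → Prop) : Prop :=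
  ∃ w : ZMod n → ZMod m, ∀ t, (ε t → w (t + 1) = w t + 1) ∧ (¬ε t → w t = w (t + 1) + 1)

theorem BalancedSigns.not {m n : ℕ} {ε : ZMod n → Prop} (h : BalancedSigns m ε) :
    BalancedSigns m fun t => ¬ε t := by
  obtain ⟨w, hw⟩ := h
  refine ⟨fun t => -w t, fun t => ⟨fun h => ?_, fun h => ?_⟩⟩
  · linear_combination (hw t).2 h
  · linear_combination (hw t).1 (not_not.1 h)

/-- A discrete antiderivative on a cyclic group: sum over representatives below t. The vanishing
total is what makes the step from n - 1 back to 0 consistent. -/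
theorem exists_partial_sum {n : ℕ} [NeZero n] {A : Type*} [AddCommGroup A] (σ : ZMod n → A)
    (h : ∑ t, σ t = 0) : ∃ w : ZMod n → A, ∀ t, w (t + 1) = w t + σ t := by
  refine ⟨fun t => ∑ s ∈ Finset.range t.val, σ s, fun t => ?_⟩
  have hlt := ZMod.val_lt t
  have h1 : ∑ s ∈ Finset.range (t.val + 1), σ s = ∑ s ∈ Finset.range t.val, σ s + σ t := by
    rw [Finset.sum_range_succ, ZMod.natCast_zmod_val]
  rcases Nat.lt_or_ge (t.val + 1) n with hn | hn
  · have : (t + 1).val = t.val + 1 := by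
      have := ZMod.val_natCast_of_lt hn
      rwa [Nat.cast_add, ZMod.natCast_zmod_val, Nat.cast_one] at this
    simp only [this, h1]
  · have hn' : t.val + 1 = n := by omega
    have h0 : t + 1 = 0 := by
      have := ZMod.natCast_self n
      rw [← hn', Nat.cast_add, hn', ZMod.natCast_zmod_val, Nat.cast_one] at this
      exact this
    have hs : ∑ s ∈ Finset.range n, σ s = ∑ t, σ t := by
      refine Finset.sum_bij' (fun s _ => (s : ZMod n)) (fun t _ => t.val) ?_ ?_ ?_ ?_ ?_
      · simp
      · intro a _; simpa using ZMod.val_lt a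
      · intro a ha; exact ZMod.val_natCast_of_lt (Finset.mem_range.1 ha)
      · intro a _; simp
      · simp
    simp only [h0, ZMod.val_zero, Finset.range_zero, Finset.sum_empty]
    rw [← h1, hn', hs, h]

/-- The signs ±1 add up to 2|ε| - n = m, which is 0 in `ZMod m`, so their partial sums define the
closed walk. -/
theorem balanced_of_card {m n : ℕ} [NeZero n] (ε : ZMod n → Prop) [DecidablePred ε]
    (h : 2 * (Finset.univ.filter ε).card = n + m) : BalancedSigns m ε := by
  obtain ⟨w, hw⟩ := exists_partial_sum (fun t => if ε t then (1 : ZMod m) else -1) (by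
    have h3 : ∀ t, (if ε t then (1 : ZMod m) else -1) = 2 * (if ε t then 1 else 0) - 1 := by
      intro t; split_ifs <;> ring
    simp only [h3]
    rw [Finset.sum_sub_distrib, ← Finset.mul_sum, Finset.sum_boole, Finset.sum_const,
      Finset.card_univ, ZMod.card, nsmul_eq_mul, mul_one]
    have := congrArg (Nat.cast (R := ZMod m)) h
    push_cast at this
    rw [this, ZMod.natCast_self]
    ring)
  refine ⟨w, fun t => ⟨fun h => ?_, fun h => ?_⟩⟩
  · rw [hw, if_pos h]
  · rw [hw, if_neg h]; ring

/-- Cycles of length `n` whose layer goes up or down at step `t` according to `ε t`. -/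
theorem isCycleFactor_of_zigzag {m n : ℕ} (hm : 3 ≤ m) (hn : 3 ≤ n)
    (g : ZMod m → (ZMod n ≃ ZMod n)) {ε : ZMod n → Prop} (hε : BalancedSigns m ε) :
    IsCycleFactor (arcGraph fun _ _ _ => True)
      (arcGraph fun x i j => ∃ t, (ε t ∧ i = g x t ∧ j = g (x + 1) (t + 1)) ∨
        (¬ε t ∧ i = g x (t + 1) ∧ j = g (x + 1) t)) n := by
  obtain ⟨w, hw⟩ := hε
  -- At time t the cycle numbered c is in layer w t + c, at the point with label t there. A vertex
  -- determines t by its label and then c by its layer.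
  let e : ZMod m × ZMod n ≃ ZMod m × ZMod n :=
    ⟨fun p => (w p.2 + p.1, g (w p.2 + p.1) p.2),
      fun q => (q.1 - w ((g q.1).symm q.2), (g q.1).symm q.2), fun p => by simp, fun q => by simp⟩
  refine isCycleFactor_of_equiv hn e (fun c t c' t' => ?_) (arcGraph_le_true (by omega) _)
  -- One half of adjacency: the arc pointing up from the first vertex. It is traversed forwards at a
  -- rising step and backwards at a falling one.
  have key : ∀ c t c' t', (w t' + c' = w t + c + 1 ∧
      ∃ u, (ε u ∧ g (w t + c) t = g (w t + c) u ∧ g (w t' + c') t' = g (w t + c + 1) (u + 1)) ∨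
        (¬ε u ∧ g (w t + c) t = g (w t + c) (u + 1) ∧ g (w t' + c') t' = g (w t + c + 1) u)) ↔
      c = c' ∧ ((ε t ∧ t' = t + 1) ∨ (¬ε t' ∧ t = t' + 1)) := by
    intro c t c' t'
    constructor
    · rintro ⟨h, u, ⟨hu, h1, h2⟩ | ⟨hu, h1, h2⟩⟩
      · rw [h] at h2
        obtain rfl := (g _).injective h1
        obtain rfl := (g _).injective h2
        rw [(hw t).1 hu] at h
        exact ⟨by linear_combination -h, Or.inl ⟨hu, rfl⟩⟩
      · rw [h] at h2
        obtain rfl := (g _).injective h1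
        obtain rfl := (g _).injective h2
        rw [(hw t').2 hu] at h
        exact ⟨by linear_combination -h, Or.inr ⟨hu, rfl⟩⟩
    · rintro ⟨rfl, ⟨hu, rfl⟩ | ⟨hu, rfl⟩⟩
      · have h : w (t + 1) + c = w t + c + 1 := by rw [(hw t).1 hu]; ring
        exact ⟨h, t, Or.inl ⟨hu, rfl, by rw [h]⟩⟩
      · have h : w t' + c = w (t' + 1) + c + 1 := by rw [(hw t').2 hu]; ring
        exact ⟨h, t', Or.inr ⟨hu, rfl, by rw [h]⟩⟩
  rw [arcGraph_adj (by omega)]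
  refine (or_congr (key c t c' t') (key c' t' c t)).trans ?_
  by_cases h1 : ε t <;> by_cases h2 : ε t' <;> simp only [h1, h2] <;> tauto

theorem two_ne_zero_zmod {n : ℕ} (hn : 3 ≤ n) : (2 : ZMod n) ≠ 0 := by
  intro h
  have h' : ((2 : ℕ) : ZMod n) = 0 := by exact_mod_cast h
  rw [ZMod.natCast_eq_zero_iff] at h'
  have := Nat.le_of_dvd (by omega) h'
  omega

/-- `(i, j)` is an edge of the cyclic sequence `h`. -/
def CyclicEdge {n : ℕ} (h : ZMod n ≃ ZMod n) (i j : ZMod n) : Prop :=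
  ∃ t, (i = h t ∧ j = h (t + 1)) ∨ (i = h (t + 1) ∧ j = h t)

/-- Equal parity makes (n + m)/2 an integer, and m ≤ n keeps it at most n. -/
theorem exists_balanced {m n : ℕ} (hm : Odd m) (hn : Odd n) (hmn : m ≤ n) :
    ∃ B : Finset (ZMod n), 2 * B.card = n + m := by
  have : NeZero n := ⟨by rintro rfl; simp at hn⟩
  obtain ⟨B, -, hB⟩ := Finset.exists_subset_card_eq (s := (Finset.univ : Finset (ZMod n)))
    (n := (n + m) / 2) (by rw [Finset.card_univ, ZMod.card]; omega)
  obtain ⟨a, rfl⟩ := hm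
  obtain ⟨b, rfl⟩ := hn
  exact ⟨B, by omega⟩

/-- Hamiltonian cycles of `ZMod n` decomposing the arcs with difference in `D`, each used twice with
opposite signs. -/
theorem decomposesInto_of_hamiltonian {m n : ℕ} (hm : Odd m) (hn : Odd n) (hm3 : 3 ≤ m)
    (hmn : m ≤ n) {D : Set (ZMod n)} {ι : Type*} [Fintype ι] (h : ι → (ZMod n ≃ ZMod n))
    (hu : ∀ i j, j - i ∈ D → ∃! s, CyclicEdge (h s) i j)
    (hD : ∀ s i j, CyclicEdge (h s) i j → j - i ∈ D) :
    DecomposesInto m n n D (Fintype.card ι * 2) := by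
  classical
  have : NeZero n := ⟨by omega⟩
  obtain ⟨B, hB⟩ := exists_balanced hm hn hmn
  have hb : BalancedSigns m (· ∈ B) := balanced_of_card _ (by simpa using hB)
  -- The two opposite sign patterns: of the two arcs carried by an edge of the cycle between
  -- consecutive layers, each pattern takes exactly one.
  let ε : Bool → ZMod n → Prop := fun b t => if b then t ∈ B else t ∉ B
  have hε : ∀ b, BalancedSigns m (ε b) := by
    rintro (_ | _)
    exacts [by simpa [ε] using hb.not, by simpa [ε] using hb]
  have hA : ∀ s : ι × Bool, ∀ i j, (∃ t, (ε s.2 t ∧ i = h s.1 t ∧ j = h s.1 (t + 1)) ∨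
        (¬ε s.2 t ∧ i = h s.1 (t + 1) ∧ j = h s.1 t)) → CyclicEdge (h s.1) i j := by
    rintro s i j ⟨t, h | h⟩
    exacts [⟨t, Or.inl h.2⟩, ⟨t, Or.inr h.2⟩]
  have := decomposesInto_of_fintype (m := m) (k := n) (D := D) (ι := ι × Bool)
    (fun s _ i j => ∃ t, (ε s.2 t ∧ i = h s.1 t ∧ j = h s.1 (t + 1)) ∨
        (¬ε s.2 t ∧ i = h s.1 (t + 1) ∧ j = h s.1 t))
    (fun s => isCycleFactor_of_zigzag hm3 (by omega) (fun _ => h s.1) (hε s.2))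
    (fun x i j hij => ?_) (fun s x i j hs => hD s.1 i j (hA s i j hs))
  · simpa using this
  · obtain ⟨s, ⟨t, ht⟩, hs'⟩ := hu i j hij
    have hloop : ∀ t t' : ZMod n, t = t' + 1 → t + 1 = t' → False := by
      intro t t' h1 h2
      apply two_ne_zero_zmod (show 3 ≤ n by omega)
      linear_combination h2 - h1
    have hεb : ∀ b b' t, (ε b t ↔ ε b' t) → b = b' := by
      rintro (_ | _) (_ | _) t h <;> simp only [ε, Bool.false_eq_true, if_true, if_false] at h <;>
        tauto
    have huniq : ∀ b b', ∀ t' t'', ((ε b t' ∧ i = h s t' ∧ j = h s (t' + 1)) ∨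
        (¬ε b t' ∧ i = h s (t' + 1) ∧ j = h s t')) → ((ε b' t'' ∧ i = h s t'' ∧ j = h s (t'' + 1)) ∨
        (¬ε b' t'' ∧ i = h s (t'' + 1) ∧ j = h s t'')) → b = b' := by
      rintro b b' t' t'' (⟨h1, rfl, rfl⟩ | ⟨h1, rfl, rfl⟩) (⟨h4, h5, h6⟩ | ⟨h4, h5, h6⟩)
      · obtain rfl := (h s).injective h5
        exact hεb _ _ _ (by tauto)
      · exact (hloop _ _ ((h s).injective h5) ((h s).injective h6)).elim
      · exact (hloop _ _ ((h s).injective h5).symm ((h s).injective h6).symm).elim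
      · obtain rfl := (h s).injective h6
        exact hεb _ _ _ (by tauto)
    have hex : ∃ b t', ((ε b t' ∧ i = h s t' ∧ j = h s (t' + 1)) ∨
        (¬ε b t' ∧ i = h s (t' + 1) ∧ j = h s t')) := by
      rcases ht with ht | ht <;> by_cases hB' : t ∈ B
      · exact ⟨true, t, Or.inl ⟨by simpa [ε] using hB', ht⟩⟩
      · exact ⟨false, t, Or.inl ⟨by simpa [ε] using hB', ht⟩⟩
      · exact ⟨false, t, Or.inr ⟨by simpa [ε] using hB', ht⟩⟩
      · exact ⟨true, t, Or.inr ⟨by simpa [ε] using hB', ht⟩⟩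
    obtain ⟨b, t', hb⟩ := hex
    refine ⟨(s, b), ⟨t', hb⟩, ?_⟩
    rintro ⟨s', b'⟩ hs
    obtain rfl := hs' s' (hA _ i j hs)
    obtain ⟨t'', ht''⟩ := hs
    exact congrArg (Prod.mk s') (huniq _ _ _ _ ht'' hb)

/-- Multiplication by a unit, as a cyclic sequence. -/
theorem decomposesInto_unit {m n : ℕ} (hm : Odd m) (hn : Odd n) (hm3 : 3 ≤ m) (hmn : m ≤ n)
    {a : ZMod n} (ha : IsUnit a) : DecomposesInto m n n {a, -a} 2 := by
  obtain ⟨u, rfl⟩ := ha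
  have := decomposesInto_of_hamiltonian hm hn hm3 hmn
    (D := ({(u : ZMod n), -(u : ZMod n)} : Set (ZMod n))) (ι := Unit) (fun _ => u.mulLeft) ?_ ?_
  · simpa using this
  · rintro i j (h | h)
    · refine ⟨(), ⟨u⁻¹ * i, Or.inl ⟨by simp, ?_⟩⟩, fun _ _ => rfl⟩
      simp only [Units.mulLeft_apply, mul_add, Units.mul_inv_cancel_left, mul_one]
      linear_combination h
    · refine ⟨(), ⟨u⁻¹ * j, Or.inr ⟨?_, by simp⟩⟩, fun _ _ => rfl⟩
      simp only [Units.mulLeft_apply, mul_add, Units.mul_inv_cancel_left, mul_one]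
      rw [Set.mem_singleton_iff] at h
      linear_combination -h
  · rintro - i j ⟨t, ⟨rfl, rfl⟩ | ⟨rfl, rfl⟩⟩ <;> simp [mul_add]

/-- An array with rows indexed by `ι`, columns by `ZMod m`, zero row sums, and every column an
enumeration of `D`. -/
theorem decomposesInto_of_array {m n : ℕ} (hm : 3 ≤ m) {D : Set (ZMod n)} {ι : Type*} [Fintype ι]
    (p : ZMod m → (ι ≃ D)) [NeZero m] (hp : ∀ r, ∑ x, (p x r : ZMod n) = 0) :
    DecomposesInto m n m D (Fintype.card ι) := by
  -- Row r gives the climbing cycles that add `p x r` when leaving layer x; `c r x` is the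
  -- displacement accumulated on reaching layer x.
  choose c hc using fun r => exists_partial_sum (fun x => (p x r : ZMod n)) (hp r)
  have key : ∀ r x i j, (∃ k, i = Equiv.addLeft (c r x) k ∧ j = Equiv.addLeft (c r (x + 1)) k) ↔
      j - i = p x r := by
    intro r x i j
    simp only [Equiv.coe_addLeft, hc]
    constructor
    · rintro ⟨k, rfl, rfl⟩; ring
    · intro h
      exact ⟨i - c r x, by ring, by rw [← h]; ring⟩
  refine decomposesInto_of_fintype
    (fun r x i j => ∃ k, i = Equiv.addLeft (c r x) k ∧ j = Equiv.addLeft (c r (x + 1)) k)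
    (fun r => isCycleFactor_of_levels hm _) (fun x i j hij => ?_) fun r x i j h => ?_
  · simp only [key]
    refine ⟨(p x).symm ⟨_, hij⟩, by simp, fun r hr => ?_⟩
    rw [Equiv.eq_symm_apply]
    exact Subtype.ext hr.symm
  · rw [(key r x i j).1 h]
    exact (p x r).2

/-! ### Five factors from the differences 0, ±2, ±4 -/

theorem exists_three_colouring {m : ℕ} (hm : 3 ≤ m) :
    ∃ τ : ZMod m → Fin 3, ∀ x, τ x ≠ τ (x + 1) := by
  have : NeZero m := ⟨by omega⟩
  refine ⟨fun x => if x.val = m - 1 then 2 else if x.val % 2 = 0 then 0 else 1, fun x => ?_⟩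
  have hlt := ZMod.val_lt x
  rcases Nat.lt_or_ge (x.val + 1) m with h | h
  · have hx : (x + 1).val = x.val + 1 := by
      have := ZMod.val_natCast_of_lt h
      rwa [Nat.cast_add, ZMod.natCast_zmod_val, Nat.cast_one] at this
    simp only [hx]
    split_ifs <;> omega
  · have hx : x + 1 = 0 := by
      have := ZMod.natCast_self m
      have h' : x.val + 1 = m := by omega
      rw [← h', Nat.cast_add, h', ZMod.natCast_zmod_val, Nat.cast_one] at this
      exact this
    simp only [hx, ZMod.val_zero]
    split_ifs <;> omega

/-- Arcs traced by the linear sequences `t ↦ d t + c` and `t ↦ d t + c'` with signs `B`. -/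
theorem linear_arc_iff {n : ℕ} {d : ZMod n} (hd : IsUnit d) (c c' i j : ZMod n)
    (B : Finset (ZMod n)) :
    (∃ t, (d * (2 * t + 1) ∈ B ∧ i = d * t + c ∧ j = d * (t + 1) + c') ∨
      (d * (2 * t + 1) ∉ B ∧ i = d * (t + 1) + c ∧ j = d * t + c')) ↔
    (j - i = c' - c + d ∧ i + j - (c + c') ∈ B) ∨
      (j - i = c' - c - d ∧ i + j - (c + c') ∉ B) := by
  obtain ⟨u, rfl⟩ := hd
  have e1 : ∀ a : ZMod n, (u : ZMod n) * (↑u⁻¹ * a) = a := fun a => by simp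
  constructor
  · rintro ⟨t, ⟨h, rfl, rfl⟩ | ⟨h, rfl, rfl⟩⟩
    · refine Or.inl ⟨by ring, ?_⟩
      convert h using 1
      ring
    · refine Or.inr ⟨by ring, ?_⟩
      convert h using 2
      ring
  · rintro (⟨h1, h2⟩ | ⟨h1, h2⟩)
    · refine ⟨↑u⁻¹ * (i - c), Or.inl ⟨?_, ?_, ?_⟩⟩
      · convert h2 using 1
        linear_combination 2 * e1 (i - c) - h1
      · linear_combination -e1 (i - c)
      · linear_combination h1 - e1 (i - c)
    · refine ⟨↑u⁻¹ * (j - c'), Or.inr ⟨?_, ?_, ?_⟩⟩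
      · convert h2 using 2
        linear_combination 2 * e1 (j - c') + h1
      · linear_combination -h1 - e1 (j - c')
      · linear_combination -e1 (j - c')

/-- Slopes of the five families of cycles with differences `0, ±2, ±4`. -/
def fiveSlope : Fin 5 → ℤ := ![-2, -2, -2, 4, 2]

/-- Offsets of the five families of cycles in a layer of a given colour. -/
def fiveOffset (p : Fin 3) : Fin 5 → ℤ :=
  ![if p = 0 then 2 else 0, if p = 1 then 2 else 0, if p = 2 then 2 else 0, 1, 0]

/-- Let p, q be the colours of consecutive layers and r the third colour; b and b' are the sign
tests for offset sums 0 and 2. Family r has difference -2 if b and 2 otherwise, and the family of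
slope 2 does the opposite. According as b' holds or not, family p has -4 or 0, family q has 0 or 4,
and the family of slope 4 has 4 or -4. Each of the five differences therefore occurs once, whatever
b and b' are. -/
theorem five_existsUnique : ∀ p q : Fin 3, p ≠ q → ∀ k ∈ [0, 2, -2, 4, -4], ∀ b b' : Bool,
    ∃! s : Fin 5, (k = fiveOffset q s - fiveOffset p s + fiveSlope s ∧
        (if fiveOffset p s + fiveOffset q s = 0 then b else b') = true) ∨
      (k = fiveOffset q s - fiveOffset p s - fiveSlope s ∧
        ¬(if fiveOffset p s + fiveOffset q s = 0 then b else b') = true) := by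
  simp only [ExistsUnique]
  decide

theorem five_mem : ∀ p q : Fin 3, p ≠ q → ∀ s,
    (fiveOffset p s + fiveOffset q s = 0 ∨ fiveOffset p s + fiveOffset q s = 2) ∧
    fiveOffset q s - fiveOffset p s + fiveSlope s ∈ [0, 2, -2, 4, -4] ∧
    fiveOffset q s - fiveOffset p s - fiveSlope s ∈ [0, 2, -2, 4, -4] := by
  decide

theorem isUnit_two_zmod {n : ℕ} (hn : Odd n) : IsUnit (2 : ZMod n) := by
  have := (ZMod.isUnit_iff_coprime 2 n).2 (Nat.coprime_two_left.2 hn)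
  exact_mod_cast this

/-- Making the sign depend on d(2t + 1) turns it into a condition on i + j alone, so all five
families can share the set B and be compared arc by arc. Proper colouring of the layers prevents an
offset sum of 4, leaving only two tests. -/
theorem decomposesInto_five {m n : ℕ} (hm : Odd m) (hn : Odd n) (hm3 : 3 ≤ m) (hmn : m ≤ n)
    (hn5 : 5 ≤ n) {f : ZMod n} (hf : IsUnit f) :
    DecomposesInto m n n {z | ∃ k ∈ ([0, 2, -2, 4, -4] : List ℤ), z = k * f} 5 := by
  have : NeZero n := ⟨by omega⟩
  obtain ⟨τ, hτ⟩ := exists_three_colouring hm3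
  obtain ⟨B, hB⟩ := exists_balanced hm hn hmn
  have h2 := isUnit_two_zmod hn
  -- Two of these integers differ by an even number of size at most 8. A nonzero multiple of an odd
  -- n ≥ 5 within that range is ±n, which is odd.
  have hinj : ∀ k ∈ ([0, 2, -2, 4, -4] : List ℤ), ∀ l ∈ ([0, 2, -2, 4, -4] : List ℤ),
      (k : ZMod n) * f = l * f → k = l := by
    intro k hk l hl h
    have h' : ((k - l : ℤ) : ZMod n) = 0 := by
      rw [Int.cast_sub, sub_eq_zero]
      exact hf.mul_left_injective h
    rw [ZMod.intCast_zmod_eq_zero_iff_dvd] at h'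
    obtain ⟨b, rfl⟩ := hn
    simp only [List.mem_cons, List.not_mem_nil, or_false] at hk hl
    by_contra hkl
    obtain ⟨c, hc⟩ := h'
    have h8 : |k - l| ≤ 8 := by
      rw [abs_le]
      constructor <;> omega
    have hc0 : c ≠ 0 := by
      rintro rfl
      simp at hc
      omega
    have hb : (b : ℤ) ≤ 3 := by
      have := Int.one_le_abs hc0
      have h9 : |k - l| = (2 * b + 1) * |c| := by
        rw [hc, abs_mul, abs_of_nonneg (by positivity)]
        push_cast; rfl
      nlinarith
    have hb2 : 2 ≤ b := by omega
    have hc2 : |c| ≤ 1 := by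
      have h9 : |k - l| = (2 * b + 1) * |c| := by
        rw [hc, abs_mul, abs_of_nonneg (by positivity)]
        push_cast; rfl
      have : (2 : ℤ) ≤ b := by exact_mod_cast hb2
      nlinarith [abs_nonneg c]
    rw [abs_le] at hc2
    have hb3 : b = 2 ∨ b = 3 := by omega
    have hc3 : c = 1 ∨ c = -1 := by omega
    rcases hb3 with rfl | rfl <;> rcases hc3 with rfl | rfl <;> push_cast at hc <;> omega
  have hslope : ∀ s, IsUnit ((fiveSlope s : ZMod n) * f) := by
    intro s
    refine IsUnit.mul ?_ hf
    have h4 : IsUnit (4 : ZMod n) := by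
      have := h2.mul h2
      norm_num at this
      exact this
    fin_cases s <;> simp [fiveSlope, h2, h4]
  choose u hu using hslope
  let g : Fin 5 → ZMod m → (ZMod n ≃ ZMod n) := fun s x =>
    (u s).mulLeft.trans (Equiv.addRight ((fiveOffset (τ x) s : ZMod n) * f))
  have hg : ∀ s x t, g s x t = fiveSlope s * f * t + fiveOffset (τ x) s * f := by
    intro s x t
    simp [g, hu]
  have hbal : ∀ s, BalancedSigns m fun t => (fiveSlope s : ZMod n) * f * (2 * t + 1) ∈ B := by
    intro s
    obtain ⟨v, hv⟩ := h2
    -- The map t ↦ d(2t + 1) is a permutation because 2 and d are units.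
    have hcard : (Finset.univ.filter fun t => (fiveSlope s : ZMod n) * f * (2 * t + 1) ∈ B).card =
        B.card := by
      refine Finset.card_bij' (fun t _ => (u s : ZMod n) * (v * t + 1))
        (fun t _ => (↑v⁻¹ : ZMod n) * (↑(u s)⁻¹ * t - 1)) ?_ ?_ ?_ ?_
      · intro t ht
        simpa [hu, hv] using ht
      · intro t ht
        rw [← hu, ← hv]
        simpa using ht
      · intro t _; simp
      · intro t _; simp
    exact balanced_of_card _ (by rw [hcard, hB])
  have := decomposesInto_of_fintype (m := m) (k := n)
    (D := {z : ZMod n | ∃ k ∈ ([0, 2, -2, 4, -4] : List ℤ), z = k * f}) (ι := Fin 5)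
    (fun s x i j => ∃ t, ((fiveSlope s : ZMod n) * f * (2 * t + 1) ∈ B ∧ i = g s x t ∧
        j = g s (x + 1) (t + 1)) ∨
      ((fiveSlope s : ZMod n) * f * (2 * t + 1) ∉ B ∧ i = g s x (t + 1) ∧ j = g s (x + 1) t))
    (fun s => isCycleFactor_of_zigzag hm3 (by omega) _ (hbal s)) ?_ ?_
  · simpa using this
  · rintro x i j ⟨k, hk, hij⟩
    classical
    have h5 := five_existsUnique _ _ (hτ x) k hk (decide (i + j ∈ B)) (decide (i + j - 2 * f ∈ B))
    convert h5 using 2 with s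
    simp only [hg]
    rw [linear_arc_iff (hu s ▸ (u s).isUnit)]
    obtain ⟨m1, m2, m3⟩ := five_mem _ _ (hτ x) s
    rw [hij]
    have e1 : ((k : ZMod n) * f = fiveOffset (τ (x + 1)) s * f - fiveOffset (τ x) s * f +
        fiveSlope s * f) ↔ k = fiveOffset (τ (x + 1)) s - fiveOffset (τ x) s + fiveSlope s := by
      refine ⟨fun h => hinj _ hk _ m2 ?_, fun h => ?_⟩
      · rw [h]; push_cast; ring
      · rw [h]; push_cast; ring
    have e2 : ((k : ZMod n) * f = fiveOffset (τ (x + 1)) s * f - fiveOffset (τ x) s * f -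
        fiveSlope s * f) ↔ k = fiveOffset (τ (x + 1)) s - fiveOffset (τ x) s - fiveSlope s := by
      refine ⟨fun h => hinj _ hk _ m3 ?_, fun h => ?_⟩
      · rw [h]; push_cast; ring
      · rw [h]; push_cast; ring
    have e3 : i + j - ((fiveOffset (τ x) s : ZMod n) * f + fiveOffset (τ (x + 1)) s * f) ∈ B ↔
        (if fiveOffset (τ x) s + fiveOffset (τ (x + 1)) s = 0 then decide (i + j ∈ B)
          else decide (i + j - 2 * f ∈ B)) = true := by
      have e4 : (fiveOffset (τ x) s : ZMod n) * f + fiveOffset (τ (x + 1)) s * f =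
          ((fiveOffset (τ x) s + fiveOffset (τ (x + 1)) s : ℤ) : ZMod n) * f := by
        push_cast; ring
      rw [e4]
      rcases m1 with h | h <;> simp [h]
    rw [e1, e2, e3]
  · intro s x i j h
    simp only [hg] at h
    rw [linear_arc_iff (hu s ▸ (u s).isUnit)] at h
    obtain ⟨m1, m2, m3⟩ := five_mem _ _ (hτ x) s
    rcases h with h | h
    · exact ⟨_, m2, by rw [h.1]; push_cast; ring⟩
    · exact ⟨_, m3, by rw [h.1]; push_cast; ring⟩

/-! ### Switching two edges of a two-regular graph -/

section Switching
variable {V : Type*}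

/-- Replace the edges `uv`, `u'v'` by `uu'`, `vv'`. -/
def switchEdges (F : SimpleGraph V) (u v u' v' : V) : SimpleGraph V :=
  F.deleteEdges {s(u, v), s(u', v')} ⊔ SimpleGraph.edge u u' ⊔ SimpleGraph.edge v v'

theorem switchEdges_adj {F : SimpleGraph V} {u v u' v' x y : V} :
    (switchEdges F u v u' v').Adj x y ↔ (F.Adj x y ∧ s(x, y) ≠ s(u, v) ∧ s(x, y) ≠ s(u', v')) ∨
      (s(x, y) = s(u, u') ∧ x ≠ y) ∨ (s(x, y) = s(v, v') ∧ x ≠ y) := by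
  have h (a b : V) : (SimpleGraph.edge a b).Adj x y ↔ s(x, y) = s(a, b) ∧ x ≠ y := by
    rw [SimpleGraph.edge_adj, Sym2.eq_iff]
  simp only [switchEdges, SimpleGraph.sup_adj, SimpleGraph.deleteEdges_adj, h,
    Set.mem_insert_iff, Set.mem_singleton_iff, not_or, or_assoc, ne_eq]

theorem switchEdges_flip (F : SimpleGraph V) (u v u' v' : V) :
    switchEdges F v u v' u' = switchEdges F u v u' v' := by
  ext x y
  simp only [switchEdges_adj, Sym2.eq_swap (a := v) (b := u), Sym2.eq_swap (a := v') (b := u')]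
  tauto

theorem switchEdges_swap (F : SimpleGraph V) (u v u' v' : V) :
    switchEdges F u' v' u v = switchEdges F u v u' v' := by
  ext x y
  simp only [switchEdges_adj, Sym2.eq_swap (a := u') (b := u), Sym2.eq_swap (a := v') (b := v)]
  tauto

/-- Every vertex has exactly two neighbours. -/
def TwoRegular (F : SimpleGraph V) : Prop := ∀ v, (F.neighborSet v).ncard = 2

theorem TwoRegular.isCycles {F : SimpleGraph V} (h : TwoRegular F) : F.IsCycles := fun v _ => h v

theorem TwoRegular.ncard_switchEdges [Finite V] {F : SimpleGraph V} (h : TwoRegular F)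
    {u v u' v' : V} (huv : F.Adj u v) (huu : ¬F.Adj u u') (h1 : u ≠ u') (h2 : v ≠ u')
    (h3 : u ≠ v') : ((switchEdges F u v u' v').neighborSet u).ncard = 2 := by
  have hN : (switchEdges F u v u' v').neighborSet u = insert u' (F.neighborSet u \ {v}) := by
    ext w
    have := huv.ne
    simp only [SimpleGraph.mem_neighborSet, switchEdges_adj, Set.mem_insert_iff, Set.mem_sdiff,
      Set.mem_singleton_iff, ne_eq, Sym2.eq_iff]
    constructor
    · rintro (⟨h4, h5, h6⟩ | ⟨⟨-, rfl⟩ | ⟨h4, h5⟩, h6⟩ | ⟨⟨h4, h5⟩ | ⟨h4, h5⟩, h6⟩)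
      · exact Or.inr ⟨h4, fun h => h5 (Or.inl ⟨trivial, h⟩)⟩
      · exact Or.inl rfl
      · exact absurd h4 h1
      · exact absurd h4 this
      · exact absurd h4 h3
    · rintro (rfl | ⟨h4, h5⟩)
      · exact Or.inr (Or.inl ⟨Or.inl ⟨trivial, rfl⟩, h1⟩)
      · refine Or.inl ⟨h4, ?_, ?_⟩
        · rintro (⟨-, h⟩ | ⟨h, -⟩)
          exacts [h5 h, this h]
        · rintro (⟨h, -⟩ | ⟨h, -⟩)
          exacts [h1 h, h3 h]
  rw [hN, Set.ncard_insert_of_notMem (fun h => huu h.1) (Set.toFinite _),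
    Set.ncard_sdiff_singleton_of_mem (show v ∈ F.neighborSet u from huv), h u]

theorem TwoRegular.switchEdges [Finite V] {F : SimpleGraph V} (h : TwoRegular F)
    {u v u' v' : V} (huv : F.Adj u v) (huv' : F.Adj u' v') (huu : ¬F.Adj u u') (hvv : ¬F.Adj v v')
    (h1 : u ≠ u') (h2 : v ≠ u') (h3 : u ≠ v') (h4 : v ≠ v') :
    TwoRegular (switchEdges F u v u' v') := by
  intro x
  by_cases hu : x = u
  · subst hu
    exact h.ncard_switchEdges huv huu h1 h2 h3
  by_cases hv : x = v
  · subst hv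
    rw [← switchEdges_flip]
    exact h.ncard_switchEdges huv.symm hvv h4 h3 h2
  by_cases hu' : x = u'
  · subst hu'
    rw [← switchEdges_swap]
    exact h.ncard_switchEdges huv' (fun h => huu h.symm) h1.symm h3.symm h2.symm
  by_cases hv' : x = v'
  · subst hv'
    rw [← switchEdges_swap, ← switchEdges_flip]
    exact h.ncard_switchEdges huv'.symm (fun h => hvv h.symm) h4.symm h2.symm h3.symm
  rw [← h x]
  congr 1
  ext w
  simp only [SimpleGraph.mem_neighborSet, switchEdges_adj, ne_eq, Sym2.eq_iff, hu, hv, hu', hv']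
  tauto

/-- The first alternative describes edges on different cycles; the second describes edges u → v and
u' → v' traversed in the same direction on one cycle. Either way the surviving paths and the two new
edges connect all four endpoints, so every deleted edge can be bypassed. -/
theorem switchEdges_reachable {F : SimpleGraph V} {u v u' v' : V} (h1 : u ≠ u') (h4 : v ≠ v')
    (h : ((F.deleteEdges {s(u, v), s(u', v')}).Reachable u v ∧
        (F.deleteEdges {s(u, v), s(u', v')}).Reachable u' v') ∨
      ((F.deleteEdges {s(u, v), s(u', v')}).Reachable v u' ∧
        (F.deleteEdges {s(u, v), s(u', v')}).Reachable u v')) :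
    (switchEdges F u v u' v').Reachable u u' ∧
      ∀ x y, F.Reachable x y → (switchEdges F u v u' v').Reachable x y := by
  set F' := switchEdges F u v u' v'
  have hle : F.deleteEdges {s(u, v), s(u', v')} ≤ F' := le_sup_left.trans le_sup_left
  have huu : F'.Reachable u u' :=
    SimpleGraph.Adj.reachable (switchEdges_adj.2 (Or.inr (Or.inl ⟨rfl, h1⟩)))
  have hvv : F'.Reachable v v' :=
    SimpleGraph.Adj.reachable (switchEdges_adj.2 (Or.inr (Or.inr ⟨rfl, h4⟩)))
  have huv : F'.Reachable u v := by
    rcases h with ⟨h, -⟩ | ⟨h, -⟩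
    · exact h.mono hle
    · exact huu.trans (h.mono hle).symm
  have huv' : F'.Reachable u' v' := huu.symm.trans (huv.trans hvv)
  refine ⟨huu, ?_⟩
  rintro x y ⟨w⟩
  induction w with
  | nil => exact SimpleGraph.Reachable.refl _
  | @cons a b c hab _ ih =>
    refine SimpleGraph.Reachable.trans ?_ ih
    by_cases e1 : s(a, b) = s(u, v)
    · rcases Sym2.eq_iff.1 e1 with ⟨rfl, rfl⟩ | ⟨rfl, rfl⟩
      exacts [huv, huv.symm]
    by_cases e2 : s(a, b) = s(u', v')
    · rcases Sym2.eq_iff.1 e2 with ⟨rfl, rfl⟩ | ⟨rfl, rfl⟩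
      exacts [huv', huv'.symm]
    exact SimpleGraph.Adj.reachable (switchEdges_adj.2 (Or.inl ⟨hab, e1, e2⟩))

/-- A cycle minus one edge is still connected, and the other deleted edge lies in another component,
where no walk from u can meet it. -/
theorem reachable_deleteEdges_pair {F : SimpleGraph V} [Finite V] (hF : F.IsCycles)
    {u v u' v' : V} (huv : F.Adj u v) (huv' : F.Adj u' v') (hd : ¬F.Reachable u u') :
    (F.deleteEdges {s(u, v), s(u', v')}).Reachable u v := by
  have h1 : ∀ x, (F.deleteEdges {s(u, v)}).Reachable u x →
      (F.deleteEdges {s(u, v), s(u', v')}).Reachable u x := by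
    rintro x ⟨w⟩
    have : ∀ y z (w : (F.deleteEdges {s(u, v)}).Walk y z), F.Reachable u y →
        (F.deleteEdges {s(u, v), s(u', v')}).Reachable y z := by
      intro y z w
      induction w with
      | nil => exact fun _ => SimpleGraph.Reachable.refl _
      | @cons a b c hab _ ih =>
        intro ha
        rw [SimpleGraph.deleteEdges_adj, Set.mem_singleton_iff] at hab
        refine SimpleGraph.Reachable.trans (SimpleGraph.Adj.reachable ?_)
          (ih (ha.trans hab.1.reachable))
        rw [SimpleGraph.deleteEdges_adj, Set.mem_insert_iff, Set.mem_singleton_iff]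
        refine ⟨hab.1, ?_⟩
        rintro (h | h)
        · exact hab.2 h
        · rcases Sym2.eq_iff.1 h with ⟨rfl, rfl⟩ | ⟨rfl, rfl⟩
          · exact hd ha
          · exact hd (ha.trans huv'.reachable.symm)
    exact this _ _ w (SimpleGraph.Reachable.refl _)
  exact h1 v (hF.reachable_deleteEdges huv)

/-- Switching two edges in different components joins these components. -/
theorem switchEdges_reachable_of_not_reachable {F : SimpleGraph V} [Finite V] (hF : F.IsCycles)
    {u v u' v' : V} (huv : F.Adj u v) (huv' : F.Adj u' v') (hd : ¬F.Reachable u u') :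
    (switchEdges F u v u' v').Reachable u u' ∧
      ∀ x y, F.Reachable x y → (switchEdges F u v u' v').Reachable x y := by
  refine switchEdges_reachable ?_ ?_ (Or.inl ⟨reachable_deleteEdges_pair hF huv huv' hd, ?_⟩)
  · rintro rfl; exact hd (SimpleGraph.Reachable.refl _)
  · rintro rfl; exact hd (huv.reachable.trans huv'.reachable.symm)
  · rw [Set.pair_comm]
    exact reachable_deleteEdges_pair hF huv' huv fun h => hd h.symm

end Switching

/-! ### Splitting a circulant graph with coprime differences into two Hamiltonian cycles -/

/-- A connected two-regular graph on `ZMod n` is a cyclic sequence. -/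
theorem exists_cyclicEdge_iff {n : ℕ} (hn : 3 ≤ n) {F : SimpleGraph (ZMod n)} (hF : TwoRegular F)
    (hc : ∀ x y, F.Reachable x y) :
    ∃ h : ZMod n ≃ ZMod n, ∀ x y, F.Adj x y ↔ CyclicEdge h x y := by
  have : NeZero n := ⟨by omega⟩
  have hne : (F.neighborSet 0).Nonempty := by
    rw [← Set.ncard_pos, hF]; norm_num
  obtain ⟨p, hp, hv⟩ := hF.isCycles.exists_cycle_toSubgraph_verts_eq_connectedComponentSupp
    (c := F.connectedComponentMk 0) (v := 0) rfl hne
  have hall : ∀ x, x ∈ p.support := by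
    intro x
    rw [← SimpleGraph.Walk.mem_verts_toSubgraph, hv]
    exact SimpleGraph.ConnectedComponent.sound (hc x 0)
  have hinj : Set.InjOn p.getVert {i | i < p.length} := by
    have := hp.getVert_injOn'
    intro i hi j hj hij
    refine this ?_ ?_ hij <;> simp only [Set.mem_ofPred_eq] at hi hj ⊢ <;> omega
  have hsurj : ∀ x, ∃ i < p.length, p.getVert i = x := by
    intro x
    obtain ⟨i, hi, hle⟩ := SimpleGraph.Walk.mem_support_iff_exists_getVert.1 (hall x)
    rcases hle.lt_or_eq with h | h
    · exact ⟨i, h, hi⟩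
    · refine ⟨0, ?_, ?_⟩
      · have := hp.three_le_length; omega
      · rw [← hi, h, p.getVert_length, p.getVert_zero]
  have hlen : p.length = n := by
    have : Function.Bijective fun i : Fin p.length => p.getVert i := by
      refine ⟨fun i j hij => Fin.ext (hinj i.2 j.2 hij), fun x => ?_⟩
      obtain ⟨i, hi, hx⟩ := hsurj x
      exact ⟨⟨i, hi⟩, hx⟩
    have := Fintype.card_of_bijective this
    rwa [Fintype.card_fin, ZMod.card] at this
  have hbij : Function.Bijective fun t : ZMod n => p.getVert t.val := by
    refine ⟨fun s t hst => ZMod.val_injective n (hinj ?_ ?_ hst), fun x => ?_⟩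
    · simpa [hlen] using ZMod.val_lt s
    · simpa [hlen] using ZMod.val_lt t
    · obtain ⟨i, hi, hx⟩ := hsurj x
      exact ⟨i, by rw [← hx]; simp only; rw [ZMod.val_natCast_of_lt (hlen ▸ hi)]⟩
  let h : ZMod n ≃ ZMod n := Equiv.ofBijective _ hbij
  have hadj : ∀ t, F.Adj (h t) (h (t + 1)) := by
    intro t
    have h1 := p.adj_getVert_succ (i := t.val) (by rw [hlen]; exact ZMod.val_lt t)
    have h2 : h (t + 1) = p.getVert (t.val + 1) := by
      rcases Nat.lt_or_ge (t.val + 1) n with hn | hn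
      · have : (t + 1).val = t.val + 1 := by
          have := ZMod.val_natCast_of_lt hn
          rwa [Nat.cast_add, ZMod.natCast_zmod_val, Nat.cast_one] at this
        change p.getVert (t + 1).val = _
        rw [this]
      · have hn' : t.val + 1 = n := by have := ZMod.val_lt t; omega
        have h0 : t + 1 = 0 := by
          have := ZMod.natCast_self n
          rw [← hn', Nat.cast_add, hn', ZMod.natCast_zmod_val, Nat.cast_one] at this
          exact this
        have h3 : p.getVert (t.val + 1) = 0 := by
          rw [show t.val + 1 = p.length by omega]
          exact p.getVert_length
        change p.getVert (t + 1).val = _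
        rw [h0, ZMod.val_zero, p.getVert_zero, h3]
    rw [h2]
    exact h1
  have h2 := two_ne_zero_zmod hn
  refine ⟨h, fun x y => ⟨fun hxy => ?_, ?_⟩⟩
  · obtain ⟨t, rfl⟩ := h.surjective x
    have hN : F.neighborSet (h t) = {h (t + 1), h (t - 1)} := by
      refine (Set.eq_of_subset_of_ncard_le ?_ ?_ (Set.toFinite _)).symm
      · rintro z (rfl | rfl)
        · exact hadj t
        · have := (hadj (t - 1)).symm
          rwa [sub_add_cancel] at this
      · rw [hF, Set.ncard_pair]
        intro h3
        apply h2
        linear_combination h.injective h3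
    have : y ∈ F.neighborSet (h t) := hxy
    rw [hN] at this
    rcases this with rfl | rfl
    · exact ⟨t, Or.inl ⟨rfl, rfl⟩⟩
    · exact ⟨t - 1, Or.inr ⟨by rw [sub_add_cancel], rfl⟩⟩
  · rintro ⟨t, ⟨rfl, rfl⟩ | ⟨rfl, rfl⟩⟩
    exacts [hadj t, (hadj t).symm]

/-- Going along a cyclic sequence from `h (p + 1)` to `h q` one avoids the edges leaving `h p`
and `h q`. -/
theorem reachable_arc {n : ℕ} (hn : 3 ≤ n) {F : SimpleGraph (ZMod n)} {h : ZMod n ≃ ZMod n}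
    (hF : ∀ x y, F.Adj x y ↔ CyclicEdge h x y) {p q : ZMod n} :
    (F.deleteEdges {s(h p, h (p + 1)), s(h q, h (q + 1))}).Reachable (h (p + 1)) (h q) := by
  have : NeZero n := ⟨by omega⟩
  have h2 := two_ne_zero_zmod hn
  have key : ∀ j ≤ (q - p - 1).val,
      (F.deleteEdges {s(h p, h (p + 1)), s(h q, h (q + 1))}).Reachable (h (p + 1))
        (h (p + 1 + j)) := by
    intro j
    induction j with
    | zero => intro _; simp
    | succ j ih =>
      intro hj
      refine (ih (by omega)).trans (SimpleGraph.Adj.reachable ?_)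
      have hlt := ZMod.val_lt (q - p - 1)
      have hq : p + 1 + (j : ZMod n) ≠ q := by
        intro hq
        have : (q - p - 1) = (j : ZMod n) := by linear_combination -hq
        have h5 := congrArg ZMod.val this
        rw [ZMod.val_natCast_of_lt (by omega)] at h5
        omega
      have hp : p + 1 + (j : ZMod n) ≠ p := by
        intro hq
        have h0 : ((j + 1 : ℕ) : ZMod n) = 0 := by push_cast; linear_combination hq
        rw [ZMod.natCast_eq_zero_iff] at h0
        have := Nat.le_of_dvd (by omega) h0
        omega
      have hs : p + 1 + ((j + 1 : ℕ) : ZMod n) = p + 1 + j + 1 := by push_cast; ring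
      rw [hs, SimpleGraph.deleteEdges_adj, hF]
      refine ⟨⟨_, Or.inl ⟨rfl, rfl⟩⟩, ?_⟩
      have aux : ∀ r, p + 1 + (j : ZMod n) ≠ r →
          s(h (p + 1 + j), h (p + 1 + j + 1)) ≠ s(h r, h (r + 1)) := by
        intro r hr he
        rcases Sym2.eq_iff.1 he with ⟨e, -⟩ | ⟨e, e'⟩
        · exact hr (h.injective e)
        · apply h2
          have e3 := h.injective e
          have e4 := h.injective e'
          linear_combination e4 - e3
      rintro (he | he)
      · exact aux p hp he
      · exact aux q hq he
  have := key _ le_rfl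
  rw [ZMod.natCast_zmod_val] at this
  convert this using 2
  ring

/-- Two disjoint two-regular graphs on `ZMod n` whose edges are the pairs with difference `±a` or
`±b`. -/
structure CirculantSplit {n : ℕ} (a b : ZMod n) (F F' : SimpleGraph (ZMod n)) : Prop where
  left : TwoRegular F
  right : TwoRegular F'
  or_iff : ∀ x y, F.Adj x y ∨ F'.Adj x y ↔ y - x = a ∨ y - x = -a ∨ y - x = b ∨ y - x = -b
  disjoint : ∀ x y, F.Adj x y → ¬F'.Adj x y

/-- The cosets of `ker χ` numbered up to `j` lie in one component of `F`, and on the others `F` has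
all edges of difference `a`. -/
def MergedUpTo {n g : ℕ} (F : SimpleGraph (ZMod n)) (χ : ZMod n →+ ZMod g) (a : ZMod n) (j : ℕ) :
    Prop :=
  (∀ x y, (χ x).val ≤ j → (χ y).val ≤ j → F.Reachable x y) ∧
    ∀ x, j < (χ x).val → F.Adj x (x + a)

theorem add_self_ne_zero {n : ℕ} (hn : Odd n) {a : ZMod n} (ha : a ≠ 0) : a + a ≠ 0 := by
  rw [← two_mul]
  exact fun h => ha ((isUnit_two_zmod hn).mul_right_eq_zero.1 h)

/-- The edges to x + a and x - a are both present and distinct since n is odd; two-regularity leaves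
room for no other. -/
theorem MergedUpTo.eq_or_eq {n g : ℕ} (hn : Odd n) {F : SimpleGraph (ZMod n)}
    (hF : TwoRegular F) {χ : ZMod n →+ ZMod g} {a : ZMod n} {j : ℕ} (ha : a ≠ 0) (hχ : χ a = 0)
    (h : MergedUpTo F χ a j) {x y : ZMod n} (hx : j < (χ x).val) (hxy : F.Adj x y) :
    y = x + a ∨ y = x - a := by
  have : NeZero n := ⟨by rintro rfl; simp at hn⟩
  have hN : F.neighborSet x = {x + a, x - a} := by
    refine (Set.eq_of_subset_of_ncard_le ?_ ?_ (Set.toFinite _)).symm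
    · rintro z (rfl | rfl)
      · exact h.2 x hx
      · have := h.2 (x - a) (by simpa [hχ] using hx)
        rw [sub_add_cancel] at this
        exact this.symm
    · rw [hF, Set.ncard_pair]
      intro h3
      exact add_self_ne_zero hn ha (by linear_combination h3)
  have : y ∈ F.neighborSet x := hxy
  rwa [hN] at this

/-- A walk starting beyond level j uses only steps ±a, so it stays in its coset. This shows that the
next coset is still a separate component. -/
theorem MergedUpTo.map_eq_of_reachable {n g : ℕ} (hn : Odd n) {F : SimpleGraph (ZMod n)}
    (hF : TwoRegular F) {χ : ZMod n →+ ZMod g} {a : ZMod n} {j : ℕ} (ha : a ≠ 0) (hχ : χ a = 0)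
    (h : MergedUpTo F χ a j) {x y : ZMod n} (hx : j < (χ x).val) (hxy : F.Reachable x y) :
    χ y = χ x := by
  obtain ⟨w⟩ := hxy
  induction w with
  | nil => rfl
  | @cons u v w huv _ ih =>
    have : χ v = χ u := by
      rcases h.eq_or_eq hn hF ha hχ hx huv with rfl | rfl <;> simp [hχ]
    rw [ih (this ▸ hx), this]

/-- Switching one parallelogram attaches the next coset. -/
theorem MergedUpTo.switchEdges {n g : ℕ} (hn : Odd n) {F : SimpleGraph (ZMod n)}
    (hF : TwoRegular F) {χ : ZMod n →+ ZMod g} {a b : ZMod n} {j : ℕ} (ha : a ≠ 0)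
    (hχa : χ a = 0) (hχb : χ b = 1) (hker : ∀ x, χ x = 0 → ∃ k : ℕ, x = k * a) (hj : j + 1 < g)
    (h : MergedUpTo F χ a j) {v : ZMod n} (hv : (χ v).val = j) (h1 : F.Adj v (v + a)) :
    MergedUpTo (switchEdges F v (v + a) (v + b) (v + a + b)) χ a (j + 1) := by
  have : NeZero n := ⟨by rintro rfl; simp at hn⟩
  have : NeZero g := ⟨by omega⟩
  have hvb : (χ (v + b)).val = j + 1 := by
    rw [map_add, hχb, ← ZMod.natCast_zmod_val (χ v), hv]
    have := ZMod.val_natCast_of_lt hj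
    push_cast at this
    exact this
  have h2 : F.Adj (v + b) (v + a + b) := by
    have := h.2 (v + b) (by omega)
    rwa [add_right_comm] at this
  have hd : ¬F.Reachable v (v + b) := fun hr => by
    have := h.map_eq_of_reachable hn hF ha hχa (by omega) hr.symm
    rw [← this] at hvb
    omega
  obtain ⟨h3, h4⟩ := switchEdges_reachable_of_not_reachable hF.isCycles h1 h2 hd
  have hlevel : ∀ x, (χ x).val ≤ j + 1 →
      (_root_.switchEdges F v (v + a) (v + b) (v + a + b)).Reachable v x := by
    intro x hx
    rcases hx.lt_or_eq with hx' | hx'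
    · exact h4 _ _ (h.1 v x hv.le (by omega))
    refine h3.trans (h4 _ _ ?_)
    obtain ⟨k, hk⟩ := hker (x - (v + b)) (by
      rw [map_sub, sub_eq_zero]; exact ZMod.val_injective g (hx'.trans hvb.symm))
    obtain rfl : x = v + b + k * a := by rw [← hk]; ring
    clear hk hx hx'
    induction k with
    | zero => simp
    | succ k ih =>
      refine ih.trans (SimpleGraph.Adj.reachable ?_)
      have := h.2 (v + b + k * a) (by
        rw [map_add _ (v + b), ← nsmul_eq_mul, map_nsmul, hχa, nsmul_zero, add_zero]; omega)
      convert this using 1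
      push_cast
      ring
  refine ⟨fun x y hx hy => (hlevel x hx).symm.trans (hlevel y hy), fun x hx => ?_⟩
  have hn' : ∀ w, (χ w).val ≤ j + 1 → χ (w + a) = χ w → s(x, x + a) ≠ s(w, w + a) := by
    intro w hw _ he
    rcases Sym2.eq_iff.1 he with ⟨rfl, -⟩ | ⟨rfl, -⟩
    · omega
    · rw [map_add, hχa, add_zero] at hx
      omega
  refine switchEdges_adj.2 (Or.inl ⟨h.2 x (by omega), hn' v (by omega) (by simp [hχa]), ?_⟩)
  rw [add_right_comm]
  exact hn' (v + b) (by omega) (by simp [hχa])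

/-- The a-sides of a parallelogram pass from F to F' and its b-sides from F' to F. Every corner
trades one side for another, so both graphs remain two-regular and their union is unchanged. -/
theorem CirculantSplit.exchange {n : ℕ} (hn : Odd n) {a b : ZMod n}
    (ha : a ≠ 0) (hb : b ≠ 0) (hab : a ≠ b) (hab' : a + b ≠ 0) {F F' : SimpleGraph (ZMod n)}
    (h : CirculantSplit a b F F') {v : ZMod n} (h1 : F.Adj v (v + a))
    (h2 : F.Adj (v + b) (v + a + b)) (h3 : F'.Adj v (v + b)) (h4 : F'.Adj (v + a) (v + a + b)) :
    CirculantSplit a b (switchEdges F v (v + a) (v + b) (v + a + b))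
      (switchEdges F' v (v + b) (v + a) (v + a + b)) := by
  have : NeZero n := ⟨by rintro rfl; simp at hn⟩
  have e1 : v ≠ v + b := by simpa using hb
  have e2 : v + a ≠ v + b := by simpa using hab
  have e3 : v ≠ v + a + b := by simpa [add_assoc] using hab'
  have e4 : v + a ≠ v + a + b := by simpa using hb
  have e5 : v ≠ v + a := by simpa using ha
  have e6 : v + b ≠ v + a + b := by rw [add_right_comm]; simpa using ha
  have key : ∀ {F : SimpleGraph (ZMod n)} {x y z w : ZMod n}, F.Adj z w → s(x, y) = s(z, w) →
      F.Adj x y := by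
    intro F x y z w hF he
    rw [← SimpleGraph.mem_edgeSet, he]
    exact hF
  refine ⟨h.left.switchEdges h1 h2 (fun h' => h.disjoint _ _ h' h3)
    (fun h' => h.disjoint _ _ h' h4) e1 e2 e3 e4, h.right.switchEdges h3 h4
    (h.disjoint _ _ h1) (h.disjoint _ _ h2) e5 e2.symm e3 e6, fun x y => ?_, fun x y => ?_⟩
  · rw [← h.or_iff, switchEdges_adj, switchEdges_adj]
    constructor
    · rintro ((⟨h, -⟩ | ⟨h, -⟩ | ⟨h, -⟩) | (⟨h, -⟩ | ⟨h, -⟩ | ⟨h, -⟩))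
      exacts [Or.inl h, Or.inr (key h3 h), Or.inr (key h4 h), Or.inr h, Or.inl (key h1 h),
        Or.inl (key h2 h)]
    · have := fun hx : F.Adj x y ∨ F'.Adj x y => show x ≠ y from hx.elim (·.ne) (·.ne)
      tauto
  · rw [switchEdges_adj, switchEdges_adj]
    have f1 := fun he => key (x := x) (y := y) h1 he
    have f2 := fun he => key (x := x) (y := y) h2 he
    have f3 := fun he => key (x := x) (y := y) h3 he
    have f4 := fun he => key (x := x) (y := y) h4 he
    have f5 := h.disjoint x y
    tauto

/-- The two deleted b-edges start at v and v + a, both in coset j, so those starting in later cosets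
survive for later switches. -/
theorem tail_switchEdges {n g : ℕ} (hn : Odd n) {F : SimpleGraph (ZMod n)}
    {χ : ZMod n →+ ZMod g} {a b : ZMod n} (hb : b ≠ 0) (hχa : χ a = 0) {j : ℕ}
    (h : ∀ x, j ≤ (χ x).val → F.Adj x (x + b)) {v : ZMod n} (hv : (χ v).val = j) :
    ∀ x, j + 1 ≤ (χ x).val → (switchEdges F v (v + b) (v + a) (v + a + b)).Adj x (x + b) := by
  intro x hx
  have aux : ∀ w, (χ w).val = j → s(x, x + b) ≠ s(w, w + b) := by
    intro w hw he
    rcases Sym2.eq_iff.1 he with ⟨rfl, -⟩ | ⟨rfl, h'⟩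
    · omega
    · exact add_self_ne_zero hn hb (by linear_combination h')
  exact switchEdges_adj.2 (Or.inl ⟨h x (by omega), aux v hv, aux (v + a) (by simpa [hχa] using hv)⟩)

theorem circulantSplit_base {n : ℕ} (hn : Odd n) {a b : ZMod n} (ha : a ≠ 0) (hb : b ≠ 0)
    (hab : a ≠ b) (hab' : a + b ≠ 0) :
    CirculantSplit a b (SimpleGraph.fromRel fun x y => y = x + a)
      (SimpleGraph.fromRel fun x y => y = x + b) := by
  have : NeZero n := ⟨by rintro rfl; simp at hn⟩
  have hadj : ∀ {c : ZMod n}, c ≠ 0 → ∀ x y, (SimpleGraph.fromRel fun x y => y = x + c).Adj x y ↔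
      y = x + c ∨ y = x - c := by
    intro c hc x y
    rw [SimpleGraph.fromRel_adj, eq_sub_iff_add_eq, eq_comm (a := y + c), and_iff_right_iff_imp]
    rintro (h | h) rfl <;> simp [hc] at h
  have hreg : ∀ {c : ZMod n}, c ≠ 0 → TwoRegular (SimpleGraph.fromRel fun x y => y = x + c) := by
    intro c hc x
    have : (SimpleGraph.fromRel fun x y => y = x + c).neighborSet x = {x + c, x - c} := by
      ext y
      exact hadj hc x y
    rw [this, Set.ncard_pair]
    intro h3
    exact add_self_ne_zero hn hc (by linear_combination h3)
  refine ⟨hreg ha, hreg hb, fun x y => ?_, fun x y => ?_⟩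
  · rw [hadj ha, hadj hb, sub_eq_iff_eq_add', sub_eq_iff_eq_add', sub_eq_iff_eq_add',
      sub_eq_iff_eq_add', or_assoc, ← sub_eq_add_neg, ← sub_eq_add_neg]
  · rw [hadj ha, hadj hb]
    rintro (rfl | rfl) (h | h)
    · exact hab (by linear_combination h)
    · exact hab' (by linear_combination h)
    · exact hab' (by linear_combination -h)
    · exact hab (by linear_combination -h)

theorem mergedUpTo_base {n g : ℕ} {a : ZMod n} (ha : a ≠ 0) {χ : ZMod n →+ ZMod g}
    (hker : ∀ x, χ x = 0 → ∃ k : ℕ, x = k * a) :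
    MergedUpTo (SimpleGraph.fromRel fun x y => y = x + a) χ a 0 ∧
      ∀ x, (SimpleGraph.fromRel fun x y => y = x + a).Adj x (x + a) := by
  have h : ∀ x, (SimpleGraph.fromRel fun x y => y = x + a).Adj x (x + a) := fun x => by
    simp [SimpleGraph.fromRel_adj, ha]
  refine ⟨⟨fun x y hx hy => ?_, fun x _ => h x⟩, h⟩
  have hxy : χ (y - x) = 0 := by
    rw [map_sub, (ZMod.val_eq_zero _).1 (Nat.le_zero.1 hx),
      (ZMod.val_eq_zero _).1 (Nat.le_zero.1 hy), sub_zero]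
  obtain ⟨k, hk⟩ := hker _ hxy
  obtain rfl : y = x + k * a := by rw [← hk]; ring
  clear hk hxy hy
  induction k with
  | zero => simp
  | succ k ih =>
    refine ih.trans (SimpleGraph.Adj.reachable ?_)
    convert h (x + k * a) using 1
    push_cast
    ring

/-- Starting from the a-cycles and the b-cycles, each switch along a diagonal of parallelograms
joins one more coset of ⟨a⟩ in F and, at the same time, one more coset of ⟨b⟩ in F'. -/
theorem exists_both_merged {n g g' : ℕ} (hn : Odd n) {a b : ZMod n} (ha : a ≠ 0) (hb : b ≠ 0)
    (hab : a ≠ b) (hab' : a + b ≠ 0) {χ : ZMod n →+ ZMod g} {χ' : ZMod n →+ ZMod g'}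
    (hχa : χ a = 0) (hχb : χ b = 1) (hker : ∀ x, χ x = 0 → ∃ k : ℕ, x = k * a)
    (hχb' : χ' b = 0) (hχa' : χ' a = 1) (hker' : ∀ x, χ' x = 0 → ∃ k : ℕ, x = k * b)
    (hg : g' ≤ g) (j : ℕ) (hj : j < g') :
    ∃ F F', CirculantSplit a b F F' ∧ MergedUpTo F χ a j ∧ MergedUpTo F' χ' b j ∧
      (∀ x, j ≤ (χ x).val → F'.Adj x (x + b)) ∧ ∀ x, j ≤ (χ' x).val → F.Adj x (x + a) := by
  induction j with
  | zero =>
    have h1 := mergedUpTo_base ha hker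
    have h2 := mergedUpTo_base hb hker'
    exact ⟨_, _, circulantSplit_base hn ha hb hab hab', h1.1, h2.1, fun x _ => h2.2 x,
      fun x _ => h1.2 x⟩
  | succ j ih =>
    obtain ⟨F, F', hs, hm, hm', ht, ht'⟩ := ih (by omega)
    -- This corner lies in coset number j for both subgroups, where neither the a-edges nor the
    -- b-edges needed have been touched.
    set v : ZMod n := j • (a + b)
    have hv : (χ v).val = j := by
      rw [map_nsmul, map_add, hχa, hχb, zero_add, nsmul_one, ZMod.val_natCast_of_lt (by omega)]
    have hv' : (χ' v).val = j := by
      rw [map_nsmul, map_add, hχa', hχb', add_zero, nsmul_one, ZMod.val_natCast_of_lt (by omega)]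
    have h1 : F.Adj v (v + a) := ht' v hv'.ge
    have h2 : F.Adj (v + b) (v + a + b) := by
      have := ht' (v + b) (by simp [hχb', hv'])
      rwa [add_right_comm] at this
    have h3 : F'.Adj v (v + b) := ht v hv.ge
    have h4 : F'.Adj (v + a) (v + a + b) := ht (v + a) (by simp [hχa, hv])
    refine ⟨_, _, hs.exchange hn ha hb hab hab' h1 h2 h3 h4,
      hm.switchEdges hn hs.left ha hχa hχb hker (by omega) hv h1, ?_,
      tail_switchEdges hn hb hχa ht hv, ?_⟩
    · rw [add_right_comm]
      exact hm'.switchEdges hn hs.right hb hχb' hχa' hker' (by omega) hv' h3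
    · rw [add_right_comm]
      exact tail_switchEdges hn ha hχb' ht' hv'

/-- Some two parallel edges of a coset are traversed in the same direction. -/
theorem exists_parallel {n g : ℕ} (hn : Odd n) {a b : ZMod n} {χ : ZMod n →+ ZMod g}
    (hχa : χ a = 0) {c : ZMod g} (hc : ∃ v, χ v = c) {h : ZMod n ≃ ZMod n}
    (hh : ∀ v, χ v = c → CyclicEdge h v (v + b)) :
    ∃ v, χ v = c ∧ ∃ p q,
      (v = h p ∧ v + b = h (p + 1) ∧ v + a = h q ∧ v + a + b = h (q + 1)) ∨
      (v = h (p + 1) ∧ v + b = h p ∧ v + a = h (q + 1) ∧ v + a + b = h q) := by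
  by_contra hcon
  push Not at hcon
  obtain ⟨v, hv⟩ := hc
  let P : ZMod n → Prop := fun v => ∃ p, v = h p ∧ v + b = h (p + 1)
  let Q : ZMod n → Prop := fun v => ∃ p, v = h (p + 1) ∧ v + b = h p
  have hPQ : ∀ v, χ v = c → P v ∨ Q v := by
    intro v hv
    obtain ⟨p, hp | hp⟩ := hh v hv
    exacts [Or.inl ⟨p, hp⟩, Or.inr ⟨p, hp⟩]
  have hP : ∀ v, χ v = c → (P (v + a) ↔ ¬P v) := by
    intro v hv
    constructor
    · rintro ⟨q, hq, hq'⟩ ⟨p, hp, hp'⟩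
      exact (hcon v hv p q).1 hp hp' hq hq'
    · intro h1
      obtain ⟨p, hp, hp'⟩ := (hPQ v hv).resolve_left h1
      refine (hPQ (v + a) (by rw [map_add, hχa, add_zero, hv])).resolve_right ?_
      rintro ⟨q, hq, hq'⟩
      exact (hcon v hv p q).2 hp hp' hq hq'
  have key : ∀ k : ℕ, P (v + k * a) ↔ (P v ↔ Even k) := by
    intro k
    induction k with
    | zero => simp
    | succ k ih =>
      have hs : v + (k + 1 : ℕ) * a = v + k * a + a := by push_cast; ring
      have hk : χ (v + k * a) = c := by
        rw [map_add, ← nsmul_eq_mul, map_nsmul, hχa, nsmul_zero, add_zero, hv]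
      rw [hs, hP _ hk, ih, Nat.even_add_one]
      by_cases h1 : P v <;> simp [h1]
  -- The direction of the b-edge alternates along v, v + a, v + 2a, …, yet returns to itself after
  -- the odd number n of steps.
  have hno := key n
  rw [show v + (n : ℕ) * a = v by simp] at hno
  by_cases h1 : P v <;> simp [h1, Nat.not_even_iff_odd.2 hn] at hno

/-- Once F' is a single cycle, F may still have unmerged cosets. Switching at a parallelogram whose
two b-edges F' traverses in the same direction attaches the next coset to F and leaves F' a single
cycle; `exists_parallel` supplies such a parallelogram. -/
theorem exists_left_merged {n g : ℕ} (hn : Odd n) (hn3 : 3 ≤ n) {a b : ZMod n} (ha : a ≠ 0)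
    (hb : b ≠ 0) (hab : a ≠ b) (hab' : a + b ≠ 0) {χ : ZMod n →+ ZMod g}
    (hχa : χ a = 0) (hχb : χ b = 1) (hker : ∀ x, χ x = 0 → ∃ k : ℕ, x = k * a) {i : ℕ}
    (hi : ∃ F F', CirculantSplit a b F F' ∧ MergedUpTo F χ a i ∧
      (∀ x, i ≤ (χ x).val → F'.Adj x (x + b)) ∧ ∀ x y, F'.Reachable x y)
    (j : ℕ) (hij : i ≤ j) (hj : j < g) :
    ∃ F F', CirculantSplit a b F F' ∧ MergedUpTo F χ a j ∧
      (∀ x, j ≤ (χ x).val → F'.Adj x (x + b)) ∧ ∀ x y, F'.Reachable x y := by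
  induction j, hij using Nat.le_induction with
  | base => exact hi
  | succ j hij ih =>
    obtain ⟨F, F', hs, hm, ht, hc⟩ := ih (by omega)
    obtain ⟨h, hh⟩ := exists_cyclicEdge_iff hn3 hs.right hc
    have hval : ∀ {v : ZMod n}, χ v = j → (χ v).val = j := fun hv => by
      rw [hv, ZMod.val_natCast_of_lt (by omega)]
    obtain ⟨v, hv, p, q, hpq⟩ := exists_parallel hn (a := a) (b := b) hχa (c := j)
      ⟨j • b, by rw [map_nsmul, hχb, nsmul_one]⟩ (h := h)
      (fun v hv => (hh _ _).1 (ht v (hval hv).ge))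
    have h3 : F'.Adj v (v + b) := ht v (hval hv).ge
    have h4 : F'.Adj (v + a) (v + a + b) := ht (v + a) (by simp [hχa, hval hv])
    have hlt : j < (χ (v + b)).val := by
      rw [map_add, hv, hχb]
      have := ZMod.val_natCast_of_lt hj
      push_cast at this
      omega
    have h5 : F.Adj (v + b) (v + a + b) := by
      have := hm.2 (v + b) hlt
      rwa [add_right_comm] at this
    -- Otherwise v and v + a would be neighbours on the cycle F'. With both b-edges pointing the
    -- same way this forces v + a = v + b or v + a + b = v.
    have h1 : F.Adj v (v + a) := by
      refine ((hs.or_iff v (v + a)).2 (Or.inl (by ring))).resolve_right fun h' => hab' ?_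
      obtain ⟨r, ⟨hr, hr'⟩ | ⟨hr, hr'⟩⟩ := (hh _ _).1 h' <;>
        rcases hpq with ⟨e1, e2, e3, e4⟩ | ⟨e1, e2, e3, e4⟩
      · exfalso
        obtain rfl := h.injective (e1.symm.trans hr)
        exact hab (by linear_combination hr' - e2)
      · have f1 := h.injective (e1.symm.trans hr)
        have f2 := h.injective (e3.symm.trans hr')
        have : q = p + 1 := by linear_combination f2 - f1
        rw [this, ← e1] at e4
        linear_combination e4
      · have f1 := h.injective (e1.symm.trans hr)
        have f2 := h.injective (e3.symm.trans hr')
        rw [f2, ← f1, ← e1] at e4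
        linear_combination e4
      · exfalso
        have f1 := h.injective (e1.symm.trans hr)
        obtain rfl : p = r := by linear_combination f1
        exact hab (by linear_combination hr' - e2)
    have hcon : ∀ x y, (switchEdges F' v (v + b) (v + a) (v + a + b)).Reachable x y := by
      have := switchEdges_reachable (F := F') (u := v) (v := v + b) (u' := v + a)
        (v' := v + a + b) (by simpa using ha) (by rw [add_right_comm]; simpa using ha) (Or.inr ?_)
      · exact fun x y => this.2 x y (hc x y)
      -- Removing the two edges leaves two arcs of the cycle, each running from the head of one
      -- removed edge to the tail of the other.
      rcases hpq with ⟨e1, e2, e3, e4⟩ | ⟨e1, e2, e3, e4⟩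
      · rw [e2, e4, e3, e1]
        refine ⟨reachable_arc hn3 hh, ?_⟩
        rw [Set.pair_comm]
        exact (reachable_arc hn3 hh).symm
      · rw [e2, e4, e3, e1, Sym2.eq_swap, Sym2.eq_swap (a := h (q + 1))]
        refine ⟨?_, reachable_arc hn3 hh⟩
        rw [Set.pair_comm]
        exact (reachable_arc hn3 hh).symm
    exact ⟨_, _, hs.exchange hn ha hb hab hab' h1 h5 h3 h4,
      hm.switchEdges hn hs.left ha hχa hχb hker (by omega) (hval hv) h1,
      tail_switchEdges hn hb hχa ht (hval hv), hcon⟩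

/-- The projection onto `ZMod n` modulo the multiples of `a`, normalized at `b`. -/
theorem exists_coset_map {n a b : ℕ} [NeZero n] (h : Nat.Coprime a b) :
    ∃ χ : ZMod n →+ ZMod (Nat.gcd a n), χ a = 0 ∧ χ b = 1 ∧
      ∀ x, χ x = 0 → ∃ k : ℕ, x = k * (a : ZMod n) := by
  set g := Nat.gcd a n
  have hgn : g ∣ n := Nat.gcd_dvd_right _ _
  have hga : g ∣ a := Nat.gcd_dvd_left _ _
  have hu : IsUnit (b : ZMod g) :=
    (ZMod.isUnit_iff_coprime b g).2 (Nat.Coprime.symm (h.coprime_dvd_left hga))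
  obtain ⟨u, hu⟩ := hu
  refine ⟨(AddMonoidHom.mulLeft (↑u⁻¹ : ZMod g)).comp
    (ZMod.castHom hgn (ZMod g)).toAddMonoidHom, ?_, ?_, fun x hx => ?_⟩
  · have : ((a : ℕ) : ZMod g) = 0 := (ZMod.natCast_eq_zero_iff _ _).2 hga
    simp [this]
  · simp [← hu]
  · have hx' : ZMod.castHom hgn (ZMod g) x = 0 := by
      have := congrArg (fun z => (u : ZMod g) * z) hx
      simpa using this
    rw [← ZMod.natCast_zmod_val x, map_natCast, ZMod.natCast_eq_zero_iff] at hx'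
    obtain ⟨c, hc⟩ := hx'
    -- Bézout modulo n: the gcd is a multiple of a, hence so is every multiple of the gcd.
    refine ⟨((c : ZMod n) * ((Nat.gcdA a n : ℤ) : ZMod n)).val, ?_⟩
    have hb := congrArg (Int.cast (R := ZMod n)) (Nat.gcd_eq_gcd_ab a n)
    push_cast at hb
    rw [ZMod.natCast_self, zero_mul, add_zero] at hb
    rw [ZMod.natCast_zmod_val, ← ZMod.natCast_zmod_val x, hc]
    push_cast
    rw [hb]
    ring

/-- Diagonal switches exhaust the smaller family of cosets, that of ⟨b⟩, so F' becomes connected;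
direction-controlled switches then finish F. Coprimality makes each of a, b a generator modulo the
other, which lets the cosets be numbered consecutively. -/
theorem exists_hamiltonian_split {n a b : ℕ} (hn : Odd n) (hn3 : 3 ≤ n) (hc : Nat.Coprime a b)
    (ha : (a : ZMod n) ≠ 0) (hb : (b : ZMod n) ≠ 0) (hab : (a : ZMod n) ≠ b)
    (hab' : (a : ZMod n) + b ≠ 0) (hle : Nat.gcd b n ≤ Nat.gcd a n) :
    ∃ F F', CirculantSplit (a : ZMod n) b F F' ∧ (∀ x y, F.Reachable x y) ∧
      ∀ x y, F'.Reachable x y := by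
  have : NeZero n := ⟨by omega⟩
  obtain ⟨χ, h1, h2, h3⟩ := exists_coset_map (n := n) hc
  obtain ⟨χ', h1', h2', h3'⟩ := exists_coset_map (n := n) hc.symm
  have hg : 0 < Nat.gcd a n := Nat.gcd_pos_of_pos_right _ (by omega)
  have hg' : 0 < Nat.gcd b n := Nat.gcd_pos_of_pos_right _ (by omega)
  have : NeZero (Nat.gcd a n) := ⟨hg.ne'⟩
  have : NeZero (Nat.gcd b n) := ⟨hg'.ne'⟩
  have hlast : ∀ {g : ℕ} [NeZero g] (z : ZMod g), z.val ≤ g - 1 := fun z => by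
    have := ZMod.val_lt z; omega
  obtain ⟨F, F', hs, hm, hm', ht, -⟩ := exists_both_merged hn ha hb hab hab' h1 h2 h3 h1' h2' h3'
    hle (Nat.gcd b n - 1) (by omega)
  obtain ⟨F, F', hs, hm, -, hF'⟩ := exists_left_merged hn hn3 ha hb hab hab' h1 h2 h3
    ⟨F, F', hs, hm, ht, fun x y => hm'.1 x y (hlast _) (hlast _)⟩ (Nat.gcd a n - 1) (by omega)
    (by omega)
  exact ⟨F, F', hs, fun x y => hm.1 x y (hlast _) (hlast _), hF'⟩

theorem decomposesInto_pair {m n a b : ℕ} (hm : Odd m) (hn : Odd n) (hm3 : 3 ≤ m) (hmn : m ≤ n)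
    (hc : Nat.Coprime a b) (ha : (a : ZMod n) ≠ 0) (hb : (b : ZMod n) ≠ 0)
    (hab : (a : ZMod n) ≠ b) (hab' : (a : ZMod n) + b ≠ 0) :
    DecomposesInto m n n ({(a : ZMod n), -(a : ZMod n)} ∪ {(b : ZMod n), -(b : ZMod n)}) 4 := by
  wlog hle : Nat.gcd b n ≤ Nat.gcd a n generalizing a b
  · rw [Set.union_comm]
    exact this hc.symm hb ha hab.symm (by rwa [add_comm]) (by omega)
  obtain ⟨F, F', hs, hF, hF'⟩ :=
    exists_hamiltonian_split hn (hm3.trans hmn) hc ha hb hab hab' hle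
  obtain ⟨h, hh⟩ := exists_cyclicEdge_iff (hm3.trans hmn) hs.left hF
  obtain ⟨h', hh'⟩ := exists_cyclicEdge_iff (hm3.trans hmn) hs.right hF'
  have hmem : ∀ i j : ZMod n, j - i ∈ ({(a : ZMod n), -(a : ZMod n)} ∪
      {(b : ZMod n), -(b : ZMod n)} : Set (ZMod n)) ↔ F.Adj i j ∨ F'.Adj i j := by
    intro i j
    rw [hs.or_iff]
    simp only [Set.mem_union, Set.mem_insert_iff, Set.mem_singleton_iff, or_assoc]
  have := decomposesInto_of_hamiltonian hm hn hm3 hmn (ι := Bool) (fun s => cond s h h')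
    (D := {(a : ZMod n), -(a : ZMod n)} ∪ {(b : ZMod n), -(b : ZMod n)}) ?_ ?_
  · simpa using this
  · intro i j hij
    rw [hmem] at hij
    rcases hij with hij | hij
    · refine ⟨true, (hh _ _).1 hij, ?_⟩
      rintro (_ | _) h1
      · exact absurd ((hh' _ _).2 h1) (hs.disjoint _ _ hij)
      · rfl
    · refine ⟨false, (hh' _ _).1 hij, ?_⟩
      rintro (_ | _) h1
      · rfl
      · exact absurd hij (hs.disjoint _ _ ((hh _ _).2 h1))
  · rintro (_ | _) i j hij
    · exact (hmem _ _).2 (Or.inr ((hh' _ _).2 hij))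
    · exact (hmem _ _).2 (Or.inl ((hh _ _).2 hij))

/-! ### From zero-sum rows to C_m-factors -/

/-- A system of rows using every element of `S` equally often splits into columns that are
enumerations of `S`. -/
theorem exists_columns {ι α : Type*} [Fintype ι] [DecidableEq α] (S : Finset α)
    (hS : Fintype.card ι = S.card) (w : ℕ) (ρ : ι → Multiset α) (hw : ∀ i, (ρ i).card = w)
    (hρ : ∑ i, ρ i = w • S.val) :
    ∃ p : Fin w → ι → α, (∀ x, Function.Injective (p x) ∧ ∀ i, p x i ∈ S) ∧
      ∀ i, ρ i = ∑ x, {p x i} := by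
  induction w generalizing ρ with
  | zero =>
    refine ⟨fun x => x.elim0, fun x => x.elim0, fun i => ?_⟩
    simpa using hw i
  | succ w ih =>
    have hcount : ∀ a, ∑ i, (ρ i).count a ≤ w + 1 := by
      intro a
      rw [← Multiset.count_sum', hρ, Multiset.count_nsmul]
      have := Multiset.nodup_iff_count_le_one.1 S.nodup a
      nlinarith
    have hmem : ∀ i, ∀ a ∈ ρ i, a ∈ S := by
      intro i a ha
      have h1 : a ∈ ∑ i, ρ i := Multiset.mem_sum.2 ⟨i, Finset.mem_univ _, ha⟩
      rw [hρ] at h1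
      exact Multiset.mem_of_mem_nsmul h1
    obtain ⟨f, hf, hfm⟩ := (Finset.all_card_le_biUnion_card_iff_exists_injective
      fun i => (ρ i).toFinset).1 fun A => by
        -- Hall's condition by double counting: the rows in A have (w + 1)|A| entries, and each
        -- value accounts for at most w + 1 of them.
        have h1 : (w + 1) * A.card ≤ (w + 1) * (A.biUnion fun i => (ρ i).toFinset).card := by
          calc (w + 1) * A.card = ∑ i ∈ A, (ρ i).card := by
                rw [Finset.sum_congr rfl fun i _ => hw i, Finset.sum_const, smul_eq_mul, mul_comm]
            _ = ∑ i ∈ A, ∑ a ∈ A.biUnion fun i => (ρ i).toFinset, (ρ i).count a := by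
                refine Finset.sum_congr rfl fun i hi => ?_
                refine (Multiset.sum_count_eq_card fun a ha => ?_).symm
                exact Finset.mem_biUnion.2 ⟨i, hi, Multiset.mem_toFinset.2 ha⟩
            _ = ∑ a ∈ A.biUnion fun i => (ρ i).toFinset, ∑ i ∈ A, (ρ i).count a :=
                Finset.sum_comm
            _ ≤ ∑ a ∈ A.biUnion fun i => (ρ i).toFinset, (w + 1) :=
                Finset.sum_le_sum fun a _ =>
                  (Finset.sum_le_sum_of_subset (Finset.subset_univ A)).trans (hcount a)
            _ = _ := by rw [Finset.sum_const, smul_eq_mul, mul_comm]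
        exact Nat.le_of_mul_le_mul_left h1 (Nat.succ_pos w)
    have hfm' : ∀ i, f i ∈ ρ i := fun i => Multiset.mem_toFinset.1 (hfm i)
    -- As there are as many rows as elements of S, the injective choice is a whole column; deleting
    -- it leaves rows of length w with the same property.
    have hsum : ∑ i, ({f i} : Multiset α) = S.val := by
      have h1 : Finset.univ.map ⟨f, hf⟩ = S := by
        refine Finset.eq_of_subset_of_card_le ?_ ?_
        · intro a ha
          obtain ⟨i, -, rfl⟩ := Finset.mem_map.1 ha
          exact hmem i _ (hfm' i)
        · rw [Finset.card_map, Finset.card_univ, hS]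
      rw [← h1, Finset.map_val, Finset.sum, Function.Embedding.coeFn_mk,
        ← Multiset.sum_map_singleton (Multiset.map f _), Multiset.map_map]
      rfl
    obtain ⟨p, hp, hp'⟩ := ih (fun i => (ρ i).erase (f i))
      (fun i => by rw [Multiset.card_erase_of_mem (hfm' i), hw]; rfl) (by
        have h1 : ∑ i, (ρ i).erase (f i) + ∑ i, {f i} = w • S.val + S.val := by
          rw [← Finset.sum_add_distrib, ← succ_nsmul, ← hρ]
          refine Finset.sum_congr rfl fun i _ => ?_
          rw [add_comm, Multiset.singleton_add, Multiset.cons_erase (hfm' i)]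
        rw [hsum] at h1
        exact add_right_cancel h1)
    refine ⟨Fin.cons f p, fun x => ?_, fun i => ?_⟩
    · refine Fin.cases ⟨hf, fun i => hmem i _ (hfm' i)⟩ (fun x => ?_) x
      exact hp x
    · rw [Fin.sum_univ_succ]
      simp only [Fin.cons_zero, Fin.cons_succ]
      rw [← hp' i, Multiset.singleton_add, Multiset.cons_erase (hfm' i)]

theorem sum_range_alternating {A : Type*} [AddCommGroup A] (c : A) (t : ℕ) :
    ∑ k ∈ Finset.range (2 * t), (if Even k then c else -c) = 0 := by
  induction t with
  | zero => simp
  | succ t ih =>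
    rw [show 2 * (t + 1) = 2 * t + 1 + 1 by ring, Finset.sum_range_succ, Finset.sum_range_succ, ih]
    simp

theorem sum_zmod_val {m : ℕ} [NeZero m] {A : Type*} [AddCommMonoid A] (f : ℕ → A) :
    ∑ x : ZMod m, f x.val = ∑ k ∈ Finset.range m, f k := by
  refine Finset.sum_nbij (fun x => x.val) (fun x _ => Finset.mem_range.2 (ZMod.val_lt x))
    (fun x _ y _ h => ZMod.val_injective m h) (fun k hk => ?_) fun _ _ => rfl
  exact ⟨k, Finset.mem_coe.2 (Finset.mem_univ _),
    ZMod.val_natCast_of_lt (Finset.mem_range.1 (Finset.mem_coe.1 hk))⟩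

/-- A symmetric set covered evenly by zero-sum rows of odd length at most `m` decomposes into
`C_m`-factors. -/
theorem decomposesInto_of_rows {m n w : ℕ} (hm : Odd m) (hm3 : 3 ≤ m) (hw : Odd w) (hwm : w ≤ m)
    {S : Finset (ZMod n)} (hneg : ∀ z ∈ S, -z ∈ S) {ι : Type*} [Fintype ι]
    (hS : Fintype.card ι = S.card) (ρ : ι → Multiset (ZMod n)) (hρ : ∀ i, (ρ i).card = w)
    (hsum : ∑ i, ρ i = w • S.val) (h0 : ∀ i, (ρ i).sum = 0) :
    DecomposesInto m n m S S.card := by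
  have : NeZero m := ⟨by omega⟩
  obtain ⟨p, hp, hp'⟩ := exists_columns S hS w ρ hρ hsum
  -- The even number m - w of extra columns repeats the first column with alternating signs: row
  -- sums are unchanged, and symmetry of S keeps each column an enumeration.
  let q : ℕ → ι → ZMod n := fun k i =>
    if h : k < w then p ⟨k, h⟩ i else
      if Even (k - w) then p ⟨0, hw.pos⟩ i else -p ⟨0, hw.pos⟩ i
  have hq : ∀ k, Function.Injective (q k) ∧ ∀ i, q k i ∈ S := by
    intro k
    simp only [q]
    split_ifs with h1 h2
    · exact hp _
    · exact hp _
    · exact ⟨neg_injective.comp (hp _).1, fun i => hneg _ ((hp _).2 i)⟩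
  let e : ℕ → (ι ≃ (S : Set (ZMod n))) := fun k => Equiv.ofBijective
    (fun i => (⟨q k i, (hq k).2 i⟩ : (S : Set (ZMod n)))) (by
      rw [Fintype.bijective_iff_injective_and_card]
      refine ⟨fun i j hij => (hq k).1 (congrArg Subtype.val hij), ?_⟩
      simpa using hS)
  rw [← hS]
  refine decomposesInto_of_array hm3 (fun x => e x.val) fun r => ?_
  change ∑ x : ZMod m, q x.val r = 0
  rw [sum_zmod_val fun k => q k r]
  obtain ⟨t, rfl⟩ : ∃ t, m = w + 2 * t := by
    obtain ⟨a, rfl⟩ := hm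
    obtain ⟨b, rfl⟩ := hw
    exact ⟨a - b, by omega⟩
  rw [Finset.sum_range_add, Finset.sum_range]
  have h1 : ∑ k : Fin w, q k r = 0 := by
    rw [← h0 r, hp' r, ← Multiset.coe_sumAddMonoidHom, map_sum]
    refine Finset.sum_congr rfl fun k _ => ?_
    simp [q]
  have h2 : ∑ k ∈ Finset.range (2 * t), q (w + k) r = 0 := by
    rw [← sum_range_alternating (p ⟨0, hw.pos⟩ r) t]
    refine Finset.sum_congr rfl fun k _ => ?_
    simp [q]
  rw [h1, h2, add_zero]

/-- Rows of length `w` with sum divisible by `n`, using every element of `S` exactly `w` times. -/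
def HasZeroSumCover (w : ℕ) (n : ℤ) (S : Finset ℤ) : Prop :=
  ∃ R : Multiset (Multiset ℤ), (∀ r ∈ R, r.card = w ∧ n ∣ r.sum) ∧ R.sum = w • S.val

theorem HasZeroSumCover.of_dvd {w : ℕ} {n d : ℤ} {S : Finset ℤ} (h : HasZeroSumCover w d S)
    (hd : n ∣ d) : HasZeroSumCover w n S := by
  obtain ⟨R, hR, hR'⟩ := h
  exact ⟨R, fun r hr => ⟨(hR r hr).1, hd.trans (hR r hr).2⟩, hR'⟩

theorem decomposesInto_of_cover {m n w : ℕ} (hm : Odd m) (hm3 : 3 ≤ m) (hw : Odd w) (hwm : w ≤ m)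
    {S : Finset ℤ} (hneg : ∀ z ∈ S, -z ∈ S) (hn : ∀ z ∈ S, 2 * z < n)
    (hS : HasZeroSumCover w n S) :
    DecomposesInto m n m {z | ∃ k ∈ S, z = (k : ZMod n)} S.card := by
  obtain ⟨R, hR, hsum⟩ := hS
  have hinj : Set.InjOn (Int.cast : ℤ → ZMod n) S := by
    intro a ha b hb hab
    have h1 := hn a ha
    have h2 := hn b hb
    have h3 := hn _ (hneg a ha)
    have h4 := hn _ (hneg b hb)
    have h5 : (n : ℤ) ∣ a - b := by
      rw [← ZMod.intCast_zmod_eq_zero_iff_dvd, Int.cast_sub, hab, sub_self]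
    have := Int.eq_zero_of_abs_lt_dvd h5 (by rw [abs_lt]; constructor <;> linarith)
    linarith
  have hcard : R.card = S.card := by
    have h1 := congrArg Multiset.card hsum
    rw [Multiset.card_nsmul, ← Multiset.cardHom_apply, map_multiset_sum] at h1
    rw [Multiset.map_congr rfl fun r hr => show Multiset.cardHom r = w from (hR r hr).1,
      Multiset.map_const', Multiset.sum_replicate,
      smul_eq_mul, mul_comm] at h1
    exact Nat.eq_of_mul_eq_mul_left hw.pos h1
  have hset : {z | ∃ k ∈ S, z = (k : ZMod n)} =
      (S.image (Int.cast : ℤ → ZMod n) : Set (ZMod n)) := by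
    ext z
    simp [eq_comm]
  rw [hset, ← Finset.card_image_of_injOn hinj]
  have hcard' : R.toList.length = S.card := by rw [Multiset.length_toList, hcard]
  have hmem : ∀ i : Fin R.toList.length, R.toList.get i ∈ R := fun i =>
    Multiset.mem_toList.1 (R.toList.get_mem i)
  refine decomposesInto_of_rows hm hm3 hw hwm ?_ (ι := Fin R.toList.length) ?_
    (fun i => (R.toList.get i).map (Int.cast : ℤ → ZMod n)) (fun i => ?_) ?_ (fun i => ?_)
  · intro z hz
    obtain ⟨k, hk, rfl⟩ := Finset.mem_image.1 hz
    exact Finset.mem_image.2 ⟨-k, hneg k hk, Int.cast_neg k⟩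
  · rw [Fintype.card_fin, hcard', Finset.card_image_of_injOn hinj]
  · rw [Multiset.card_map, (hR _ (hmem i)).1]
  · have h1 : ∑ i, R.toList.get i = R.sum := by
      rw [← List.sum_ofFn, List.ofFn_get, Multiset.sum_toList]
    rw [Finset.image_val_of_injOn hinj, ← Multiset.map_nsmul, ← hsum, ← h1,
      ← Multiset.coe_mapAddMonoidHom, map_sum]
  · have h1 := map_multiset_sum (Int.castAddHom (ZMod n)) (R.toList.get i)
    rw [Int.coe_castAddHom] at h1
    rw [← h1, ZMod.intCast_zmod_eq_zero_iff_dvd]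
    exact (hR _ (hmem i)).2

theorem map_val_eq_self {α : Type*} [DecidableEq α] {S : Finset α} {f : α → α}
    (hf : ∀ a ∈ S, f a ∈ S) (hinj : ∀ a ∈ S, ∀ b ∈ S, f a = f b → a = b) : S.val.map f = S.val := by
  rw [← Finset.image_val_of_injOn (s := S) (fun a ha b hb => hinj a ha b hb)]
  congr 1
  refine Finset.eq_of_subset_of_card_le (Finset.image_subset_iff.2 hf) ?_
  rw [Finset.card_image_of_injOn (fun a ha b hb => hinj a ha b hb)]

/-! ### Zero-sum triples covering an interval -/

/-- The cyclic shift of `[-N, N]` by `N`. -/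
def halfShift (N x : ℤ) : ℤ := if x ≤ 0 then x + N else x - N - 1

/-- The zero-sum row starting with `x`. -/
def shiftRow (N x : ℤ) : Multiset ℤ := {x} + {halfShift N x} + {-x - halfShift N x}

theorem shiftRow_sum (N x : ℤ) : (shiftRow N x).sum = 0 := by
  simp [shiftRow]

theorem shiftRow_card (N x : ℤ) : (shiftRow N x).card = 3 := by
  simp [shiftRow]

/-- Each of the three entries runs through the whole interval. The third is -2x - N for x ≤ 0 and
-2x + N + 1 for x > 0, giving the two parity classes separately. -/
theorem sum_shiftRow (N : ℤ) :
    ∑ x ∈ Finset.Icc (-N) N, shiftRow N x = 3 • (Finset.Icc (-N) N).val := by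
  have h1 : (Finset.Icc (-N) N).val.map (halfShift N) = (Finset.Icc (-N) N).val := by
    refine map_val_eq_self (fun a ha => ?_) fun a ha b hb => ?_ <;>
      simp only [Finset.mem_Icc, halfShift] at * <;> split_ifs <;> omega
  have h2 : (Finset.Icc (-N) N).val.map (fun x => -x - halfShift N x) =
      (Finset.Icc (-N) N).val := by
    refine map_val_eq_self (fun a ha => ?_) fun a ha b hb => ?_ <;>
      simp only [Finset.mem_Icc, halfShift] at * <;> split_ifs <;> omega
  have h3 : ∀ f : ℤ → ℤ, ∑ x ∈ Finset.Icc (-N) N, ({f x} : Multiset ℤ) =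
      (Finset.Icc (-N) N).val.map f := by
    intro f
    rw [Finset.sum, ← Multiset.sum_map_singleton (Multiset.map f _), Multiset.map_map]
    rfl
  simp only [shiftRow, Finset.sum_add_distrib, h3]
  rw [h1, h2, Multiset.map_id', succ_nsmul, two_nsmul]

theorem hasZeroSumCover_Icc (N : ℤ) : HasZeroSumCover 3 0 (Finset.Icc (-N) N) := by
  refine ⟨(Finset.Icc (-N) N).val.map (shiftRow N), fun r hr => ?_, sum_shiftRow N⟩
  obtain ⟨x, -, rfl⟩ := Multiset.mem_map.1 hr
  exact ⟨shiftRow_card N x, (shiftRow_sum N x).symm ▸ dvd_rfl⟩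

/-! ### Trading away 0, ±2, ±4 uniformly in the length -/

/-- The value at `M` of a linear expression given by slope and constant term. -/
def evalAt (M : ℤ) (p : ℤ × ℤ) : ℤ := p.1 * M + p.2

theorem evalAt_nonneg {M : ℤ} (hM : 8 ≤ M) {p : ℤ × ℤ} (h : 0 ≤ p.1) (h' : 0 ≤ 8 * p.1 + p.2) :
    0 ≤ evalAt M p := by
  have := mul_le_mul_of_nonneg_left hM h
  rw [evalAt]
  linarith

/-- Nonpositive at all arguments from `8` on. -/
def EventuallyNonpos (p : ℤ × ℤ) : Prop := p.1 ≤ 0 ∧ 8 * p.1 + p.2 ≤ 0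

instance : DecidablePred EventuallyNonpos := fun _ => inferInstanceAs (Decidable (_ ∧ _))

/-- Positive at all arguments from `8` on. -/
def EventuallyPos (p : ℤ × ℤ) : Prop := 0 ≤ p.1 ∧ 0 < 8 * p.1 + p.2

instance : DecidablePred EventuallyPos := fun _ => inferInstanceAs (Decidable (_ ∧ _))

theorem EventuallyNonpos.evalAt_nonpos {M : ℤ} (hM : 8 ≤ M) {p : ℤ × ℤ} (h : EventuallyNonpos p) :
    evalAt M p ≤ 0 := by
  have := evalAt_nonneg hM (p := -p) (by simpa using h.1) (by have := h.2; simp; linarith)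
  simp only [evalAt, Prod.fst_neg, Prod.snd_neg] at this ⊢
  linarith

theorem EventuallyPos.evalAt_pos {M : ℤ} (hM : 8 ≤ M) {p : ℤ × ℤ} (h : EventuallyPos p) :
    0 < evalAt M p := by
  have := mul_le_mul_of_nonneg_left hM h.1
  have := h.2
  rw [evalAt]
  linarith

/-- The zero-sum row starting with `p` and `q`. -/
def formalRow (p q : ℤ × ℤ) : List (ℤ × ℤ) := [p, q, (-p.1 - q.1, -p.2 - q.2)]

/-- The shift of `[-N, N]` by `N = 2 M + e`, formally in `M`. -/
def formalShift (e : ℤ) (p : ℤ × ℤ) : ℤ × ℤ :=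
  if EventuallyNonpos p then (p.1 + 2, p.2 + e) else (p.1 - 2, p.2 - e - 1)

/-- The sign of the linear form is constant for M ≥ 8, so the formal and the actual shift take the
same branch. -/
theorem map_formalRow_shift {M e : ℤ} (hM : 8 ≤ M) {p : ℤ × ℤ}
    (hp : EventuallyNonpos p ∨ EventuallyPos p) :
    ((formalRow p (formalShift e p)).map (evalAt M) : Multiset ℤ) =
      shiftRow (2 * M + e) (evalAt M p) := by
  have h1 : evalAt M (formalShift e p) = halfShift (2 * M + e) (evalAt M p) := by
    rw [formalShift, halfShift]
    split_ifs with h2 h3 h3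
    · simp only [evalAt]; ring
    · exact absurd (h2.evalAt_nonpos hM) h3
    · exact absurd ((hp.resolve_left h2).evalAt_pos hM) h3.not_gt
    · simp only [evalAt]; ring
  have h2 : evalAt M (-p.1 - (formalShift e p).1, -p.2 - (formalShift e p).2) =
      -evalAt M p - evalAt M (formalShift e p) := by
    simp only [evalAt]; ring
  simp only [formalRow, List.map_cons, List.map_nil, h2, shiftRow, h1]
  rfl

/-- Replacing the rows that start in `X` by the rows `A` removes the elements `0, ±2, ±4`. -/
theorem hasZeroSumCover_of_trade {M e : ℤ} (hM : 8 ≤ M) (X : List (ℤ × ℤ))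
    (A : List ((ℤ × ℤ) × (ℤ × ℤ)))
    (hX : ∀ p ∈ X, (EventuallyNonpos p ∨ EventuallyPos p) ∧
      EventuallyNonpos (p.1 - 2, p.2 - e) ∧ EventuallyNonpos (-2 - p.1, -e - p.2))
    (hlt : X.Pairwise fun p q => EventuallyPos (q.1 - p.1, q.2 - p.2))
    (h : List.Perm ((A.flatMap fun r => formalRow r.1 r.2) ++
        ([0, 2, -2, 4, -4, 0, 2, -2, 4, -4, 0, 2, -2, 4, -4].map fun k => (0, k)))
      (X.flatMap fun p => formalRow p (formalShift e p))) (he : 0 ≤ e) :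
    HasZeroSumCover 3 0 (Finset.Icc (-(2 * M + e)) (2 * M + e) \ {0, 2, -2, 4, -4}) := by
  set N := 2 * M + e
  have hnd : (X.map (evalAt M)).Nodup := by
    rw [List.Nodup, List.pairwise_map]
    refine hlt.imp fun {p q} hpq hne => ?_
    have := hpq.evalAt_pos hM
    simp only [evalAt] at this hne
    linarith
  have hsub : (X.map (evalAt M)).toFinset ⊆ Finset.Icc (-N) N := by
    intro x hx
    obtain ⟨p, hp, rfl⟩ := List.mem_map.1 (List.mem_toFinset.1 hx)
    have h1 := (hX p hp).2.1.evalAt_nonpos hM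
    have h2 := (hX p hp).2.2.evalAt_nonpos hM
    simp only [evalAt] at h1 h2
    rw [Finset.mem_Icc, evalAt]
    constructor <;> linarith
  have hE : ({0, 2, -2, 4, -4} : Finset ℤ) ⊆ Finset.Icc (-N) N := by
    intro x hx
    simp only [Finset.mem_insert, Finset.mem_singleton] at hx
    rw [Finset.mem_Icc]
    omega
  let B : Multiset (Multiset ℤ) :=
    (A.map fun r => (((formalRow r.1 r.2).map (evalAt M) : List ℤ) : Multiset ℤ) : List _)
  have hflat : ∀ {γ : Type} (l : List γ) (g : γ → List ℤ),
      ((l.map fun r => (g r : Multiset ℤ)).sum : Multiset ℤ) = (l.flatMap g : List ℤ) := by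
    intro γ l g
    induction l with
    | nil => rfl
    | cons a l ih => rw [List.map_cons, List.sum_cons, ih, List.flatMap_cons, Multiset.coe_add]
  have hBX : B.sum + 3 • ({0, 2, -2, 4, -4} : Finset ℤ).val =
      ∑ x ∈ (X.map (evalAt M)).toFinset, shiftRow N x := by
    have h1 := Multiset.coe_eq_coe.2 (h.map (evalAt M))
    rw [List.map_append, List.map_flatMap, List.map_flatMap, ← Multiset.coe_add] at h1
    rw [List.sum_toFinset _ hnd, List.map_map]
    have h2 : X.map (shiftRow N ∘ evalAt M) = X.map fun p =>
        ((formalRow p (formalShift e p)).map (evalAt M) : Multiset ℤ) :=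
      List.map_congr_left fun p hp => (map_formalRow_shift hM (hX p hp).1).symm
    rw [h2, hflat, ← h1, Multiset.sum_coe, hflat]
    congr 1
    simp [evalAt]
    decide
  -- Rows starting outside X are kept. The identity `hBX` says that the rows of X have the same
  -- entries as the replacements together with three copies of the five removed elements.
  refine ⟨(Finset.Icc (-N) N \ (X.map (evalAt M)).toFinset).val.map (shiftRow N) + B,
    fun r hr => ?_, ?_⟩
  · rcases Multiset.mem_add.1 hr with hr | hr
    · obtain ⟨x, -, rfl⟩ := Multiset.mem_map.1 hr
      exact ⟨shiftRow_card N x, (shiftRow_sum N x).symm ▸ dvd_rfl⟩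
    · obtain ⟨⟨p, q⟩, -, rfl⟩ := List.mem_map.1 (Multiset.mem_coe.1 hr)
      refine ⟨rfl, ?_⟩
      rw [Multiset.sum_coe, zero_dvd_iff]
      simp only [formalRow, evalAt, List.map_cons, List.map_nil, List.sum_cons, List.sum_nil]
      ring
  · refine add_right_cancel (b := 3 • ({0, 2, -2, 4, -4} : Finset ℤ).val) ?_
    rw [Multiset.sum_add, add_assoc, hBX]
    have h1 := Finset.sum_sdiff (f := shiftRow N) hsub
    rw [Finset.sum] at h1
    rw [h1, sum_shiftRow, ← nsmul_add, Finset.sdiff_val,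
      tsub_add_cancel_of_le (Finset.val_le_iff.2 hE)]

/-- Rows containing small entries start near a multiple of M, so X consists of clusters near 0, ±M
and ±2M. Its 33 rows are replaced by 28, with entries linear in M; one finite check therefore serves
all M ≥ 8. -/
theorem hasZeroSumCover_even {M : ℤ} (hM : 8 ≤ M) :
    HasZeroSumCover 3 0 (Finset.Icc (-(2 * M)) (2 * M) \ {0, 2, -2, 4, -4}) := by
  have := hasZeroSumCover_of_trade (e := 0) hM
    [(-2, 0), (-2, 1), (-2, 2), (-2, 3), (-2, 4), (-1, -3), (-1, -2), (-1, -1), (-1, 0), (-1, 1),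
    (-1, 2), (-1, 3), (0, -4), (0, -3), (0, -2), (0, -1), (0, 0), (0, 1), (0, 2), (0, 3), (0, 4),
    (1, -3), (1, -2), (1, -1), (1, 0), (1, 1), (1, 2), (1, 3), (1, 4), (2, -3), (2, -2), (2, -1),
    (2, 0)]
    [((-1, -3), (-1, 3)), ((-2, 7), (0, -7)), ((-2, 5), (0, -5)), ((1, -2), (1, 2)),
    ((0, 7), (2, -7)), ((1, -1), (1, 1)), ((-1, -2), (-1, 3)), ((-2, 2), (0, -1)),
    ((-1, -1), (-1, 2)), ((0, 3), (2, -4)), ((1, -3), (1, 2)), ((1, -1), (1, 0)),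
    ((-1, 1), (-1, 1)), ((-2, 8), (0, -6)), ((-1, 0), (-1, 2)), ((0, 1), (2, -3)),
    ((1, -2), (1, 0)), ((-2, 6), (0, -3)), ((-2, 4), (0, -1)), ((0, 1), (2, -4)),
    ((0, 5), (2, -8)), ((0, 3), (2, -6)), ((0, 1), (2, -5)), ((-1, -1), (0, -3)), ((0, 3), (1, 1)),
    ((-1, 0), (0, -3)), ((-1, -2), (0, -1)), ((0, 6), (1, -3))]
    (by decide) (by decide) (by decide) (by decide)
  rwa [add_zero] at this

theorem hasZeroSumCover_odd {M : ℤ} (hM : 8 ≤ M) :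
    HasZeroSumCover 3 0 (Finset.Icc (-(2 * M + 1)) (2 * M + 1) \ {0, 2, -2, 4, -4}) :=
  hasZeroSumCover_of_trade (e := 1) hM
    [(-2, -1), (-2, 0), (-2, 1), (-2, 2), (-2, 3), (-1, -4), (-1, -3), (-1, -2), (-1, -1), (-1, 0),
    (-1, 1), (-1, 2), (-1, 3), (0, -4), (0, -3), (0, -2), (0, -1), (0, 0), (0, 1), (0, 2), (0, 3),
    (0, 4), (1, -2), (1, -1), (1, 0), (1, 1), (1, 2), (1, 3), (1, 4), (2, -2), (2, -1), (2, 0),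
    (2, 1)]
    [((-1, -3), (-1, 2)), ((-2, 4), (0, -5)), ((-1, -3), (-1, 2)), ((1, -2), (1, 3)),
    ((1, 0), (1, 1)), ((1, -1), (1, 2)), ((-1, 0), (-1, 0)), ((-2, 7), (0, -7)),
    ((-2, 6), (0, -6)), ((1, -2), (1, 2)), ((0, 3), (2, -3)), ((0, 1), (2, -1)),
    ((-1, -2), (-1, 3)), ((-2, 2), (0, -1)), ((0, 6), (2, -7)), ((0, 5), (2, -6)),
    ((1, -1), (1, 0)), ((-2, 5), (0, -3)), ((-2, 3), (0, -1)), ((-1, 1), (-1, 1)),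
    ((0, 1), (2, -3)), ((0, 3), (2, -5)), ((0, 1), (2, -4)), ((-1, -1), (0, -3)),
    ((-1, -1), (0, -3)), ((0, 7), (1, -3)), ((0, 3), (1, 1)), ((-1, -2), (0, -1))]
    (by decide) (by decide) (by decide) (by decide)

/-! ### Differences up to sign -/

/-- The residues whose distance from `0` lies in `L`. -/
def magSet (n : ℕ) (L : Set ℕ) : Set (ZMod n) := {z | z.valMinAbs.natAbs ∈ L}

theorem natAbs_valMinAbs_eq_iff {n j : ℕ} (hj : 2 * j < n) {z : ZMod n} :
    z.valMinAbs.natAbs = j ↔ z = j ∨ z = -(j : ZMod n) := by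
  have : NeZero n := ⟨by omega⟩
  constructor
  · rintro rfl
    rcases Int.natAbs_eq z.valMinAbs with h | h
    · left
      rw [← Int.cast_natCast, ← h, ZMod.coe_valMinAbs]
    · right
      rw [← Int.cast_natCast, ← Int.cast_neg, ← h, ZMod.coe_valMinAbs]
  · rintro (rfl | rfl)
    · rw [ZMod.valMinAbs_natCast_of_le_half (by omega), Int.natAbs_natCast]
    · rw [ZMod.natAbs_valMinAbs_neg, ZMod.valMinAbs_natCast_of_le_half (by omega),
        Int.natAbs_natCast]

theorem magSet_singleton {n j : ℕ} (hj : 2 * j < n) :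
    magSet n {j} = {(j : ZMod n), -(j : ZMod n)} := by
  ext z
  exact natAbs_valMinAbs_eq_iff hj

theorem two_mul_natAbs_valMinAbs_lt {n : ℕ} (hn : Odd n) (z : ZMod n) :
    2 * z.valMinAbs.natAbs < n := by
  have : NeZero n := ⟨by rintro rfl; simp at hn⟩
  have := ZMod.natAbs_valMinAbs_le z
  obtain ⟨k, rfl⟩ := hn
  omega

theorem cast_image_eq_magSet {n : ℕ} (hn : Odd n) {S : Finset ℤ} (hneg : ∀ z ∈ S, -z ∈ S)
    (hS : ∀ z ∈ S, 2 * z < n) :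
    {z | ∃ k ∈ S, z = (k : ZMod n)} = magSet n {j | (j : ℤ) ∈ S} := by
  have habs : ∀ k ∈ S, (k.natAbs : ℤ) ∈ S := by
    intro k hk
    rcases Int.natAbs_eq k with h | h
    · rwa [← h]
    · have := hneg k hk
      rwa [h, neg_neg] at this
  ext z
  constructor
  · rintro ⟨k, hk, rfl⟩
    have h1 : (k : ZMod n).valMinAbs.natAbs = k.natAbs := by
      rw [natAbs_valMinAbs_eq_iff (by have := hS _ (habs k hk); omega)]
      rcases Int.natAbs_eq k with h | h
      · left
        rw [← Int.cast_natCast, ← h]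
      · right
        rw [← Int.cast_natCast, ← Int.cast_neg, ← h]
    change (((k : ZMod n).valMinAbs.natAbs : ℕ) : ℤ) ∈ S
    rw [h1]
    exact habs k hk
  · intro hz
    have hz' : ((z.valMinAbs.natAbs : ℕ) : ℤ) ∈ S := hz
    rcases (natAbs_valMinAbs_eq_iff (two_mul_natAbs_valMinAbs_lt hn z)).1 rfl with h | h
    · exact ⟨_, hz', by rw [Int.cast_natCast]; exact h⟩
    · exact ⟨_, hneg _ hz', by rw [Int.cast_neg, Int.cast_natCast]; exact h⟩

theorem DecomposesInto.magSet_union {m n k r r' : ℕ} {L L' : Set ℕ}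
    (h : DecomposesInto m n k (magSet n L) r) (h' : DecomposesInto m n k (magSet n L') r')
    (hd : Disjoint L L') : DecomposesInto m n k (magSet n (L ∪ L')) (r + r') :=
  h.union h' (hd.preimage _)

theorem decomposesInto_magSet_of_cover {m n w : ℕ} (hm : Odd m) (hn : Odd n) (hm3 : 3 ≤ m)
    (hw : Odd w) (hwm : w ≤ m) {S : Finset ℤ} (hneg : ∀ z ∈ S, -z ∈ S) (hS : ∀ z ∈ S, 2 * z < n)
    (h : HasZeroSumCover w n S) :
    DecomposesInto m n m (magSet n {j | (j : ℤ) ∈ S}) S.card := by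
  rw [← cast_image_eq_magSet hn hneg hS]
  exact decomposesInto_of_cover hm hm3 hw hwm hneg hS h

/-- Scaling the block {0, ±2, ±4} by the inverse of 2 gives {0, ±1, ±2}. -/
theorem decomposesInto_zero_one_two {m n : ℕ} (hm : Odd m) (hn : Odd n) (hm3 : 3 ≤ m)
    (hmn : m ≤ n) (hn5 : 5 ≤ n) : DecomposesInto m n n (magSet n {0, 1, 2}) 5 := by
  obtain ⟨u, hu⟩ := isUnit_two_zmod hn
  have h := decomposesInto_five hm hn hm3 hmn hn5 (u⁻¹).isUnit
  convert h using 1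
  have h1 := cast_image_eq_magSet hn (S := {0, 1, -1, 2, -2}) (by decide) (by
    simp only [Finset.mem_insert, Finset.mem_singleton]
    rintro z (rfl | rfl | rfl | rfl | rfl) <;> omega)
  have h2 : {j : ℕ | (j : ℤ) ∈ ({0, 1, -1, 2, -2} : Finset ℤ)} = {0, 1, 2} := by
    ext j
    simp only [Finset.mem_insert, Finset.mem_singleton, Set.mem_insert_iff, Set.mem_singleton_iff,
      Set.mem_ofPred_eq]
    omega
  have h3 : ∀ k : ℤ, ((2 * k : ℤ) : ZMod n) * ((u⁻¹ : (ZMod n)ˣ) : ZMod n) = k := by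
    intro k
    rw [Int.cast_mul, Int.cast_ofNat, ← hu, mul_comm, Units.inv_mul_cancel_left]
  rw [h2] at h1
  rw [← h1]
  ext z
  constructor
  · rintro ⟨k, hk, rfl⟩
    refine ⟨2 * k, ?_, (h3 k).symm⟩
    revert k
    decide
  · rintro ⟨k, hk, rfl⟩
    have : ∃ l ∈ ({0, 1, -1, 2, -2} : Finset ℤ), k = 2 * l := by
      revert k
      decide
    obtain ⟨l, hl, rfl⟩ := this
    exact ⟨l, hl, h3 l⟩

theorem decomposesInto_zero_two_four {m n : ℕ} (hm : Odd m) (hn : Odd n) (hm3 : 3 ≤ m)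
    (hmn : m ≤ n) (hn9 : 9 ≤ n) : DecomposesInto m n n (magSet n {0, 2, 4}) 5 := by
  have h := decomposesInto_five hm hn hm3 hmn (by omega) isUnit_one
  convert h using 1
  have h1 := cast_image_eq_magSet hn (S := {0, 2, -2, 4, -4}) (by decide) (by
    simp only [Finset.mem_insert, Finset.mem_singleton]
    rintro z (rfl | rfl | rfl | rfl | rfl) <;> omega)
  have h2 : {j : ℕ | (j : ℤ) ∈ ({0, 2, -2, 4, -4} : Finset ℤ)} = {0, 2, 4} := by
    ext j
    simp only [Finset.mem_insert, Finset.mem_singleton, Set.mem_insert_iff, Set.mem_singleton_iff,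
      Set.mem_ofPred_eq]
    omega
  rw [h2] at h1
  rw [← h1]
  ext z
  simp

theorem decomposesInto_magSet_unit {m n j : ℕ} (hm : Odd m) (hn : Odd n) (hm3 : 3 ≤ m)
    (hmn : m ≤ n) (hj : 2 * j < n) (hc : j.Coprime n) :
    DecomposesInto m n n (magSet n {j}) 2 := by
  rw [magSet_singleton hj]
  exact decomposesInto_unit hm hn hm3 hmn ((ZMod.isUnit_iff_coprime j n).2 hc)

theorem decomposesInto_magSet_pair {m n a b : ℕ} (hm : Odd m) (hn : Odd n) (hm3 : 3 ≤ m)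
    (hmn : m ≤ n) (ha0 : a ≠ 0) (hb0 : b ≠ 0) (ha : 2 * a < n) (hb : 2 * b < n) (hab : a ≠ b)
    (hc : a.Coprime b) : DecomposesInto m n n (magSet n {a, b}) 4 := by
  have hne : ∀ c : ℕ, c ≠ 0 → c < n → (c : ZMod n) ≠ 0 := by
    intro c hc0 hcn h
    rw [ZMod.natCast_eq_zero_iff] at h
    exact absurd (Nat.le_of_dvd (by omega) h) (by omega)
  have h := decomposesInto_pair hm hn hm3 hmn hc (hne a ha0 (by omega)) (hne b hb0 (by omega))
    (fun h => hab ?_) (by rw [← Nat.cast_add]; exact hne (a + b) (by omega) (by omega))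
  · rw [← magSet_singleton ha, ← magSet_singleton hb] at h
    exact h
  · have := congrArg ZMod.val h
    rwa [ZMod.val_natCast_of_lt (by omega), ZMod.val_natCast_of_lt (by omega)] at this

/-- All the differences from `j` on decompose into Hamiltonian factors, by consecutive pairs. -/
theorem decomposesInto_magSet_Icc {m h : ℕ} (hm : Odd m) (hm3 : 3 ≤ m)
    (hmn : m ≤ 2 * h + 1) (r : ℕ) :
    ∀ j, 1 ≤ j → j + r = h + 1 →
      DecomposesInto m (2 * h + 1) (2 * h + 1) (magSet (2 * h + 1) (Set.Icc j h)) (2 * r) := by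
  have hn : Odd (2 * h + 1) := ⟨h, rfl⟩
  induction r using Nat.strong_induction_on with
  | _ r ih =>
    intro j hj hr
    match r with
    | 0 =>
      rw [Set.Icc_eq_empty (by omega)]
      exact decomposesInto_empty _ _ _
    | 1 =>
      -- An odd number of differences leaves h unpaired, and h is coprime to 2h + 1.
      obtain rfl : j = h := by omega
      rw [Set.Icc_self]
      refine decomposesInto_magSet_unit hm hn hm3 hmn (by omega) ?_
      simp [Nat.coprime_mul_right_add_right]
    | r + 2 =>
      have h1 := decomposesInto_magSet_pair hm hn hm3 hmn (a := j) (b := j + 1) (by omega)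
        (by omega) (by omega) (by omega) (by omega) (by simp)
      have h2 := ih r (by omega) (j + 2) (by omega) (by omega)
      have h3 := h1.magSet_union h2 (by
        rw [Set.disjoint_left]
        simp only [Set.mem_insert_iff, Set.mem_singleton_iff, Set.mem_Icc]
        omega)
      convert h3 using 2
      · ext x
        simp only [Set.mem_union, Set.mem_insert_iff, Set.mem_singleton_iff, Set.mem_Icc]
        omega
      · ring

theorem mem_HWP_of_magSets {m n α β : ℕ} (hn : Odd n) (hm3 : 3 ≤ m) {S R : Set ℕ}
    (hS : DecomposesInto m n m (magSet n S) α) (hR : DecomposesInto m n n (magSet n R) β)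
    (hd : Disjoint S R) (hc : ∀ j, 2 * j < n → j ∈ S ∨ j ∈ R) :
    (α, β) ∈ HWP (lexEmpty (SimpleGraph.cycleGraph m) n) m n := by
  refine mem_HWP_of_decomposesInto hm3 hS ?_
  convert hR using 1
  ext z
  constructor
  · exact (hc _ (two_mul_natAbs_valMinAbs_lt hn z)).resolve_left
  · exact fun hz hz' => Set.disjoint_left.1 hd hz' hz

theorem magSet_list_units {m n : ℕ} (hm : Odd m) (hn : Odd n) (hm3 : 3 ≤ m) (hmn : m ≤ n)
    (U : List ℕ) (hU : ∀ u ∈ U, u.Coprime n) (hlt : ∀ u ∈ U, 2 * u < n) (hnd : U.Nodup) :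
    DecomposesInto m n n (magSet n {j | j ∈ U}) (2 * U.length) := by
  induction U with
  | nil => simpa [magSet] using decomposesInto_empty m n n
  | cons u U ih =>
    rw [List.nodup_cons] at hnd
    rw [List.forall_mem_cons] at hU hlt
    have := (decomposesInto_magSet_unit hm hn hm3 hmn hlt.1 hU.1).magSet_union
      (ih hU.2 hlt.2 hnd.2) (Set.disjoint_singleton_left.2 hnd.1)
    convert this using 2
    · ext x
      simp
    · rw [List.length_cons]
      ring

theorem magSet_list_pairs {m n : ℕ} (hm : Odd m) (hn : Odd n) (hm3 : 3 ≤ m) (hmn : m ≤ n)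
    (P : List (ℕ × ℕ)) (hP : ∀ p ∈ P, p.1.Coprime p.2)
    (hlt : ∀ x ∈ P.flatMap fun p => [p.1, p.2], x ≠ 0 ∧ 2 * x < n)
    (hnd : (P.flatMap fun p => [p.1, p.2]).Nodup) :
    DecomposesInto m n n (magSet n {j | j ∈ P.flatMap fun p => [p.1, p.2]}) (4 * P.length) := by
  induction P with
  | nil => simpa [magSet] using decomposesInto_empty m n n
  | cons p P ih =>
    rw [List.flatMap_cons] at hnd hlt
    rw [List.nodup_append'] at hnd
    rw [List.forall_mem_cons] at hP
    rw [List.forall_mem_append] at hlt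
    have h1 := hlt.1 p.1 (by simp)
    have h2 := hlt.1 p.2 (by simp)
    have := (decomposesInto_magSet_pair hm hn hm3 hmn h1.1 h2.1 h1.2 h2.2
      (by simpa using hnd.1) hP.1).magSet_union (ih hP.2 hlt.2 hnd.2.1) (by
        rw [Set.disjoint_left]
        intro x hx
        exact hnd.2.2 (by simpa using hx))
    convert this using 2
    · ext x
      simp [or_assoc]
    · rw [List.length_cons]
      ring

/-! ### Explicit solutions for even α from 6 to 26 -/

/-- The elements of `L` and their negatives. -/
def signedList (L : List ℕ) : List ℤ := L.map (fun j : ℕ => (j : ℤ)) ++ L.map fun j : ℕ => -(j : ℤ)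

/-- The rows `R` and their negatives. -/
def withNeg (R : List (List ℤ)) : List (List ℤ) := R ++ R.map (List.map Neg.neg)

theorem signedList_nodup {L : List ℕ} (hL : L.Nodup) (h0 : 0 ∉ L) : (signedList L).Nodup := by
  rw [signedList, List.nodup_append']
  refine ⟨hL.map Nat.cast_injective, hL.map (neg_injective.comp Nat.cast_injective), ?_⟩
  intro x hx hx'
  obtain ⟨a, ha, rfl⟩ := List.mem_map.1 hx
  obtain ⟨b, hb, hab⟩ := List.mem_map.1 hx'
  obtain rfl : a = 0 := by omega
  exact h0 ha

theorem hasZeroSumCover_of_list {w : ℕ} {n : ℤ} {L : List ℕ} (hL : L.Nodup) (h0 : 0 ∉ L)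
    (rows : List (List ℤ)) (hrows : ∀ r ∈ rows, r.length = w ∧ n ∣ r.sum)
    (hperm : rows.flatten.Perm (List.replicate w (signedList L)).flatten) :
    HasZeroSumCover w n (signedList L).toFinset := by
  have hsum : ∀ l : List (List ℤ), (l.map fun r : List ℤ => (r : Multiset ℤ)).sum =
      (l.flatten : List ℤ) := by
    intro l
    induction l with
    | nil => rfl
    | cons a l ih => rw [List.map_cons, List.sum_cons, ih, List.flatten_cons, Multiset.coe_add]
  refine ⟨(rows.map fun r : List ℤ => (r : Multiset ℤ) : List _), fun r hr => ?_, ?_⟩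
  · obtain ⟨l, hl, rfl⟩ := List.mem_map.1 (Multiset.mem_coe.1 hr)
    exact ⟨(hrows l hl).1, by rw [Multiset.sum_coe]; exact (hrows l hl).2⟩
  · rw [Multiset.sum_coe, hsum, Multiset.coe_eq_coe.2 hperm, ← hsum, List.map_replicate,
      List.sum_replicate, List.toFinset_val, (signedList_nodup hL h0).dedup]

theorem zeroOneTwo_decomposes {m h : ℕ} (hm : Odd m) (hm3 : 3 ≤ m) (hmn : m ≤ 2 * h + 1)
    (hh : 5 ≤ 2 * h + 1) :
    DecomposesInto m (2 * h + 1) (2 * h + 1) (magSet (2 * h + 1) {j | j ∈ [0, 1, 2]}) 5 := by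
  simpa [magSet] using decomposesInto_zero_one_two hm ⟨h, rfl⟩ hm3 hmn hh

theorem zeroTwoFour_decomposes {m h : ℕ} (hm : Odd m) (hm3 : 3 ≤ m) (hmn : m ≤ 2 * h + 1)
    (hh : 9 ≤ 2 * h + 1) :
    DecomposesInto m (2 * h + 1) (2 * h + 1) (magSet (2 * h + 1) {j | j ∈ [0, 2, 4]}) 5 := by
  simpa [magSet] using decomposesInto_zero_two_four hm ⟨h, rfl⟩ hm3 hmn hh

/-- A solution from a cover of the differences in `L`, a set `T` with five Hamiltonian factors,
units `U`, coprime pairs `P`, and all the differences from `t` on. -/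
theorem mem_HWP_of_table {m h w : ℕ} (hm : Odd m) (hm3 : 3 ≤ m) (hmn : m ≤ 2 * h + 1)
    (hw : Odd w) (hwm : w ≤ m) {T : List ℕ}
    (hT : DecomposesInto m (2 * h + 1) (2 * h + 1) (magSet (2 * h + 1) {j | j ∈ T}) 5)
    (h0 : 0 ∈ T) (hT3 : T.length = 3) (L U : List ℕ) (P : List (ℕ × ℕ)) (rows : List (List ℤ))
    {d : ℤ} (hd : ((2 * h + 1 : ℕ) : ℤ) ∣ d) (hrows : ∀ r ∈ rows, r.length = w ∧ d ∣ r.sum)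
    (hflat : rows.flatten.Perm (List.replicate w (signedList L)).flatten) {t : ℕ}
    (hperm : (T ++ (L ++ (U ++ P.flatMap fun p => [p.1, p.2]))).Perm (List.range t))
    (ht : t ≤ h + 1) (hU : ∀ u ∈ U, u.Coprime (2 * h + 1)) (hP : ∀ p ∈ P, p.1.Coprime p.2) :
    (2 * L.length, 2 * h + 1 - 2 * L.length) ∈
      HWP (lexEmpty (SimpleGraph.cycleGraph m) (2 * h + 1)) m (2 * h + 1) := by
  have hn : Odd (2 * h + 1) := ⟨h, rfl⟩
  set Q := P.flatMap fun p => [p.1, p.2] with hQ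
  have hnd := hperm.nodup_iff.2 List.nodup_range
  have hmem : ∀ x, (x ∈ T ∨ x ∈ L ∨ x ∈ U ∨ x ∈ Q) ↔ x < t := by
    intro x
    rw [← List.mem_range, ← hperm.mem_iff]
    simp only [List.mem_append]
  rw [List.nodup_append'] at hnd
  obtain ⟨-, hnd, hdT⟩ := hnd
  rw [List.nodup_append'] at hnd
  obtain ⟨hL, hnd, hdL⟩ := hnd
  rw [List.nodup_append'] at hnd
  obtain ⟨hU', hQ', hdU⟩ := hnd
  have hT' : ∀ x, x ∈ L ∨ x ∈ U ∨ x ∈ Q → x ≠ 0 := by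
    rintro x hx rfl
    exact hdT h0 (by simpa only [List.mem_append] using hx)
  have hcardQ : Q.length = 2 * P.length := by
    rw [hQ, List.length_flatMap]
    simp [mul_comm]
  have hlen := hperm.length_eq
  simp only [List.length_append, List.length_range, hT3, hcardQ] at hlen
  have hc := hasZeroSumCover_of_list hL (fun hx => hT' 0 (Or.inl hx) rfl) rows hrows hflat
  have hsigned : ∀ x : ℤ, x ∈ (signedList L).toFinset ↔ x.natAbs ∈ L := by
    intro x
    simp only [signedList, List.mem_toFinset, List.mem_append, List.mem_map]
    constructor
    · rintro (⟨a, ha, rfl⟩ | ⟨a, ha, rfl⟩) <;> simpa using ha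
    · intro hx
      rcases Int.natAbs_eq x with h | h
      · exact Or.inl ⟨_, hx, h.symm⟩
      · exact Or.inr ⟨_, hx, h.symm⟩
  have hS := decomposesInto_magSet_of_cover hm hn hm3 hw hwm (fun z hz => by
      rw [hsigned, Int.natAbs_neg]; exact (hsigned z).1 hz) (fun z hz => by
      have := (hmem _).1 (Or.inr (Or.inl ((hsigned z).1 hz))); omega) (hc.of_dvd hd)
  have hset : {j : ℕ | (j : ℤ) ∈ (signedList L).toFinset} = {j | j ∈ L} := by
    ext j
    rw [Set.mem_ofPred_eq, hsigned, Int.natAbs_natCast]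
    rfl
  have hcard : (signedList L).toFinset.card = 2 * L.length := by
    rw [List.toFinset_card_of_nodup (signedList_nodup hL fun hx => hT' 0 (Or.inl hx) rfl)]
    simp [signedList, two_mul]
  rw [hset, hcard] at hS
  have hRU := magSet_list_units hm hn hm3 hmn U hU (fun u hu => by
    have := (hmem u).1 (Or.inr (Or.inr (Or.inl hu))); omega) hU'
  have hRP := magSet_list_pairs hm hn hm3 hmn P hP (fun u hu => ⟨hT' u (Or.inr (Or.inr hu)), by
    have := (hmem u).1 (Or.inr (Or.inr (Or.inr hu))); omega⟩) hQ'
  have ht0 : 0 < t := (hmem 0).1 (Or.inl h0)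
  have hRt := decomposesInto_magSet_Icc hm hm3 hmn (h + 1 - t) t ht0 (by omega)
  have hR := ((hT.magSet_union hRU ?_).magSet_union hRP ?_).magSet_union hRt ?_
  · refine mem_HWP_of_magSets hn hm3 hS (?_ : DecomposesInto _ _ _ _ _)
      (R := (({j | j ∈ T} ∪ {j | j ∈ U}) ∪ {j | j ∈ Q}) ∪ Set.Icc t h) ?_ ?_
    · convert hR using 1
      omega
    · rw [Set.disjoint_left]
      rintro x hx (((hx' | hx') | hx') | hx')
      · exact hdT hx' (List.mem_append_left _ hx)
      · exact hdL hx (List.mem_append_left _ hx')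
      · exact hdL hx (List.mem_append_right _ hx')
      · have := (hmem x).1 (Or.inr (Or.inl hx))
        exact absurd hx'.1 (by omega)
    · intro j hj
      rcases Nat.lt_or_ge j t with h | h
      · rcases (hmem j).2 h with h | h | h | h
        exacts [Or.inr (Or.inl (Or.inl (Or.inl h))), Or.inl h,
          Or.inr (Or.inl (Or.inl (Or.inr h))), Or.inr (Or.inl (Or.inr h))]
      · exact Or.inr (Or.inr ⟨h, by omega⟩)
  · rw [Set.disjoint_left]
    intro x hx hx'
    exact hdT hx (List.mem_append_right _ (List.mem_append_left _ hx'))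
  · rw [Set.disjoint_left]
    rintro x (hx | hx) hx'
    · exact hdT hx (List.mem_append_right _ (List.mem_append_right _ hx'))
    · exact hdU hx hx'
  · rw [Set.disjoint_left]
    intro x hx hx'
    have : x < t := by
      refine (hmem x).1 ?_
      rcases hx with (hx | hx) | hx
      exacts [Or.inl hx, Or.inr (Or.inr (Or.inl hx)), Or.inr (Or.inr (Or.inr hx))]
    exact absurd hx'.1 (by omega)

/-- For small h the rows may sum to zero only modulo n, and the units must be coprime to that
particular n. The last table has integer row sums zero (`d = 0`) and only coprime pairs, so it does
not depend on n. The other lemmas of this kind follow the same pattern. -/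
theorem mem_HWP_six {m h : ℕ} (hm : Odd m) (hm3 : 3 ≤ m) (hmn : m ≤ 2 * h + 1)
    (hh : 5 ≤ h) (hex : ¬(m = 3 ∧ h = 5)) :
    (6, 2 * h + 1 - 6) ∈ HWP (lexEmpty (SimpleGraph.cycleGraph m) (2 * h + 1)) m (2 * h + 1) := by
  rcases (by omega : h = 5 ∨ h = 6 ∨ 7 ≤ h) with
    rfl | rfl | hh'
  -- Rows of width five are used here, hence m ≥ 5; this is the source of the exception (3, 11, 6).
  · exact mem_HWP_of_table (w := 5) hm hm3 hmn (by decide) (by obtain ⟨k, hk⟩ := hm; omega)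
      (zeroOneTwo_decomposes hm hm3 hmn (by omega)) (by decide) rfl
      [3, 4, 5] [] []
      (withNeg [[-5, 3, 3, 5, 5], [-5, -4, 3, 3, 3], [-5, 4, 4, 4, 4]])
      (d := 11) (by decide) (by decide) (by decide) (t := 6) (by decide) (by omega)
      (by simp) (by decide)
  · exact mem_HWP_of_table (w := 3) hm hm3 hmn (by decide) hm3
      (zeroTwoFour_decomposes hm hm3 hmn (by omega)) (by decide) rfl
      [1, 5, 6] [3] []
      (withNeg [[-6, 1, 5], [-6, 1, 5], [-6, 1, 5]])
      (d := 13) (by decide) (by decide) (by decide) (t := 7) (by decide) (by omega)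
      (by decide) (by decide)
  · exact mem_HWP_of_table (w := 3) hm hm3 hmn (by decide) hm3
      (zeroTwoFour_decomposes hm hm3 hmn (by omega)) (by decide) rfl
      [1, 5, 6] [] [(3, 7)]
      (withNeg [[-6, 1, 5], [-6, 1, 5], [-6, 1, 5]])
      (d := 0) (dvd_zero _) (by decide) (by decide) (t := 8) (by decide) (by omega)
      (by simp) (by decide)

theorem mem_HWP_eight {m h : ℕ} (hm : Odd m) (hm3 : 3 ≤ m) (hmn : m ≤ 2 * h + 1)
    (hh : 6 ≤ h) (hex : ¬(m = 3 ∧ (h = 6 ∨ h = 7))) :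
    (8, 2 * h + 1 - 8) ∈ HWP (lexEmpty (SimpleGraph.cycleGraph m) (2 * h + 1)) m (2 * h + 1) := by
  rcases (by omega : h = 6 ∨ h = 7 ∨ h = 8 ∨ h = 9 ∨ h = 10 ∨ h = 11 ∨ 12 ≤ h) with
    rfl | rfl | rfl | rfl | rfl | rfl | hh'
  -- This table and the next again have width five, whence the exceptions (3, 13, 8) and (3, 15, 8).
  · exact mem_HWP_of_table (w := 5) hm hm3 hmn (by decide) (by obtain ⟨k, hk⟩ := hm; omega)
      (zeroOneTwo_decomposes hm hm3 hmn (by omega)) (by decide) rfl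
      [3, 4, 5, 6] [] []
      (withNeg [[-6, 3, 5, 5, 6], [-4, 3, 3, 5, 6], [-6, 3, 5, 5, 6], [-4, -4, -4, -4, 3]])
      (d := 13) (by decide) (by decide) (by decide) (t := 7) (by decide) (by omega)
      (by simp) (by decide)
  · exact mem_HWP_of_table (w := 5) hm hm3 hmn (by decide) (by obtain ⟨k, hk⟩ := hm; omega)
      (zeroOneTwo_decomposes hm hm3 hmn (by omega)) (by decide) rfl
      [3, 5, 6, 7] [4] []
      (withNeg [[-7, 3, 5, 7, 7], [-5, 3, 5, 5, 7], [-6, 3, 5, 6, 7], [-6, -6, 3, 3, 6]])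
      (d := 15) (by decide) (by decide) (by decide) (t := 8) (by decide) (by omega)
      (by decide) (by decide)
  · exact mem_HWP_of_table (w := 3) hm hm3 hmn (by decide) hm3
      (zeroOneTwo_decomposes hm hm3 hmn (by omega)) (by decide) rfl
      [3, 4, 6, 7] [5, 8] []
      (withNeg [[4, 6, 7], [4, 6, 7], [-7, 3, 4], [-6, 3, 3]])
      (d := 17) (by decide) (by decide) (by decide) (t := 9) (by decide) (by omega)
      (by decide) (by decide)
  · exact mem_HWP_of_table (w := 3) hm hm3 hmn (by decide) hm3
      (zeroOneTwo_decomposes hm hm3 hmn (by omega)) (by decide) rfl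
      [3, 4, 7, 8] [5, 6, 9] []
      (withNeg [[3, 8, 8], [-7, 3, 4], [-7, 3, 4], [4, 7, 8]])
      (d := 19) (by decide) (by decide) (by decide) (t := 10) (by decide) (by omega)
      (by decide) (by decide)
  · exact mem_HWP_of_table (w := 3) hm hm3 hmn (by decide) hm3
      (zeroOneTwo_decomposes hm hm3 hmn (by omega)) (by decide) rfl
      [3, 6, 7, 9] [4, 5, 8, 10] []
      (withNeg [[7, 7, 7], [-6, 3, 3], [3, 9, 9], [6, 6, 9]])
      (d := 21) (by decide) (by decide) (by decide) (t := 11) (by decide) (by omega)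
      (by decide) (by decide)
  · exact mem_HWP_of_table (w := 3) hm hm3 hmn (by decide) hm3
      (zeroOneTwo_decomposes hm hm3 hmn (by omega)) (by decide) rfl
      [3, 5, 8, 10] [4, 6, 7, 9, 11] []
      (withNeg [[-8, 3, 5], [-8, 3, 5], [3, 10, 10], [5, 8, 10]])
      (d := 23) (by decide) (by decide) (by decide) (t := 12) (by decide) (by omega)
      (by decide) (by decide)
  · exact mem_HWP_of_table (w := 3) hm hm3 hmn (by decide) hm3
      (zeroOneTwo_decomposes hm hm3 hmn (by omega)) (by decide) rfl
      [3, 6, 9, 12] [] [(4, 5), (7, 8), (10, 11)]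
      (withNeg [[-12, 3, 9], [-12, 3, 9], [-12, 6, 6], [-9, 3, 6]])
      (d := 0) (dvd_zero _) (by decide) (by decide) (t := 13) (by decide) (by omega)
      (by simp) (by decide)

theorem mem_HWP_ten {m h : ℕ} (hm : Odd m) (hm3 : 3 ≤ m) (hmn : m ≤ 2 * h + 1)
    (hh : 7 ≤ h) :
    (10, 2 * h + 1 - 10) ∈ HWP (lexEmpty (SimpleGraph.cycleGraph m) (2 * h + 1)) m (2 * h + 1) := by
  rcases (by omega : h = 7 ∨ h = 8 ∨ h = 9 ∨ h = 10 ∨ h = 11 ∨ h = 12 ∨ h = 13 ∨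
      h = 14 ∨ 15 ≤ h) with
    rfl | rfl | rfl | rfl | rfl | rfl | rfl | rfl | hh'
  · exact mem_HWP_of_table (w := 3) hm hm3 hmn (by decide) hm3
      (zeroOneTwo_decomposes hm hm3 hmn (by omega)) (by decide) rfl
      [3, 4, 5, 6, 7] [] []
      (withNeg [[4, 5, 6], [3, 5, 7], [3, 5, 7], [3, 6, 6], [4, 4, 7]])
      (d := 15) (by decide) (by decide) (by decide) (t := 8) (by decide) (by omega)
      (by simp) (by decide)
  · exact mem_HWP_of_table (w := 3) hm hm3 hmn (by decide) hm3
      (zeroOneTwo_decomposes hm hm3 hmn (by omega)) (by decide) rfl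
      [3, 4, 5, 6, 8] [7] []
      (withNeg [[4, 5, 8], [-8, 4, 4], [-8, 3, 5], [-6, 3, 3], [5, 6, 6]])
      (d := 17) (by decide) (by decide) (by decide) (t := 9) (by decide) (by omega)
      (by decide) (by decide)
  · exact mem_HWP_of_table (w := 3) hm hm3 hmn (by decide) hm3
      (zeroOneTwo_decomposes hm hm3 hmn (by omega)) (by decide) rfl
      [3, 4, 5, 7, 8] [6, 9] []
      (withNeg [[-8, 3, 5], [-8, 3, 5], [-7, 3, 4], [5, 7, 7], [-8, 4, 4]])
      (d := 19) (by decide) (by decide) (by decide) (t := 10) (by decide) (by omega)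
      (by decide) (by decide)
  · exact mem_HWP_of_table (w := 3) hm hm3 hmn (by decide) hm3
      (zeroOneTwo_decomposes hm hm3 hmn (by omega)) (by decide) rfl
      [3, 4, 6, 7, 8] [5] [(9, 10)]
      (withNeg [[-7, 3, 4], [-6, 3, 3], [-8, 4, 4], [6, 7, 8], [6, 7, 8]])
      (d := 21) (by decide) (by decide) (by decide) (t := 11) (by decide) (by omega)
      (by decide) (by decide)
  · exact mem_HWP_of_table (w := 3) hm hm3 hmn (by decide) hm3
      (zeroOneTwo_decomposes hm hm3 hmn (by omega)) (by decide) rfl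
      [3, 4, 6, 7, 10] [5, 8, 9, 11] []
      [[-6, -4, 10], [-6, -4, 10], [-4, -3, 7], [-10, -7, -6], [-7, 3, 4], [-7, 3, 4],
       [-10, 3, 7], [-10, 4, 6], [-3, -3, 6], [6, 7, 10]]
      (d := 23) (by decide) (by decide) (by decide) (t := 12) (by decide) (by omega)
      (by decide) (by decide)
  · exact mem_HWP_of_table (w := 3) hm hm3 hmn (by decide) hm3
      (zeroOneTwo_decomposes hm hm3 hmn (by omega)) (by decide) rfl
      [3, 4, 5, 7, 10] [6, 8, 9, 11, 12] []
      (withNeg [[-7, 3, 4], [-7, 3, 4], [-7, 3, 4], [5, 10, 10], [-10, 5, 5]])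
      (d := 25) (by decide) (by decide) (by decide) (t := 13) (by decide) (by omega)
      (by decide) (by decide)
  · exact mem_HWP_of_table (w := 3) hm hm3 hmn (by decide) hm3
      (zeroOneTwo_decomposes hm hm3 hmn (by omega)) (by decide) rfl
      [3, 4, 7, 8, 11] [] [(5, 6), (9, 10), (12, 13)]
      (withNeg [[-7, 3, 4], [-7, 3, 4], [-11, 3, 8], [-11, 4, 7], [8, 8, 11]])
      (d := 27) (by decide) (by decide) (by decide) (t := 14) (by decide) (by omega)
      (by simp) (by decide)
  · exact mem_HWP_of_table (w := 3) hm hm3 hmn (by decide) hm3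
      (zeroOneTwo_decomposes hm hm3 hmn (by omega)) (by decide) rfl
      [3, 4, 7, 11, 14] [5, 6, 8, 9, 10, 12, 13] []
      [[-11, -3, 14], [-11, -3, 14], [-4, -3, 7], [-14, -11, -4], [-7, -4, 11], [-14, 3, 11],
       [-14, 7, 7], [-7, 3, 4], [-7, 3, 4], [4, 11, 14]]
      (d := 29) (by decide) (by decide) (by decide) (t := 15) (by decide) (by omega)
      (by decide) (by decide)
  · exact mem_HWP_of_table (w := 3) hm hm3 hmn (by decide) hm3
      (zeroOneTwo_decomposes hm hm3 hmn (by omega)) (by decide) rfl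
      [3, 6, 9, 12, 15] [] [(4, 5), (7, 8), (10, 11), (13, 14)]
      [[-15, 6, 9], [-15, 6, 9], [-15, 3, 12], [-9, -6, 15], [-12, -3, 15], [-12, -3, 15],
       [-12, 3, 9], [-6, -6, 12], [-9, -3, 12], [-9, 3, 6]]
      (d := 0) (dvd_zero _) (by decide) (by decide) (t := 16) (by decide) (by omega)
      (by simp) (by decide)

/-- The block and the table exhaust the magnitudes below 9, and the integer row sums vanish, so no
separate treatment of small n is needed. -/
theorem mem_HWP_twelve {m h : ℕ} (hm : Odd m) (hm3 : 3 ≤ m) (hmn : m ≤ 2 * h + 1)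
    (hh : 8 ≤ h) :
    (12, 2 * h + 1 - 12) ∈ HWP (lexEmpty (SimpleGraph.cycleGraph m) (2 * h + 1)) m (2 * h + 1) := by
  exact mem_HWP_of_table (w := 3) hm hm3 hmn (by decide) hm3
    (zeroTwoFour_decomposes hm hm3 hmn (by omega)) (by decide) rfl
      [1, 3, 5, 6, 7, 8] [] []
    (withNeg [[-8, 3, 5], [-8, 3, 5], [-8, 3, 5], [-7, 1, 6], [-7, 1, 6], [-7, 1, 6]])
    (d := 0) (dvd_zero _) (by decide) (by decide) (t := 9) (by decide) (by omega)
    (by simp) (by decide)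

theorem mem_HWP_fourteen {m h : ℕ} (hm : Odd m) (hm3 : 3 ≤ m) (hmn : m ≤ 2 * h + 1)
    (hh : 9 ≤ h) :
    (14, 2 * h + 1 - 14) ∈ HWP (lexEmpty (SimpleGraph.cycleGraph m) (2 * h + 1)) m (2 * h + 1) := by
  rcases (by omega : h = 9 ∨ h = 10 ∨ 11 ≤ h) with
    rfl | rfl | hh'
  · exact mem_HWP_of_table (w := 3) hm hm3 hmn (by decide) hm3
      (zeroOneTwo_decomposes hm hm3 hmn (by omega)) (by decide) rfl
      [3, 4, 5, 6, 7, 8, 9] [] []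
      (withNeg [[4, 6, 9], [4, 6, 9], [4, 7, 8], [5, 7, 7], [-9, 3, 6], [-8, 3, 5], [-8, 3, 5]])
      (d := 19) (by decide) (by decide) (by decide) (t := 10) (by decide) (by omega)
      (by simp) (by decide)
  · exact mem_HWP_of_table (w := 3) hm hm3 hmn (by decide) hm3
      (zeroOneTwo_decomposes hm hm3 hmn (by omega)) (by decide) rfl
      [3, 4, 6, 7, 8, 9, 10] [5] []
      (withNeg [[4, 8, 9], [4, 8, 9], [6, 7, 8], [-9, 3, 6], [-10, 4, 6], [-10, 3, 7],
       [-10, 3, 7]])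
      (d := 21) (by decide) (by decide) (by decide) (t := 11) (by decide) (by omega)
      (by decide) (by decide)
  · exact mem_HWP_of_table (w := 3) hm hm3 hmn (by decide) hm3
      (zeroOneTwo_decomposes hm hm3 hmn (by omega)) (by decide) rfl
      [3, 4, 5, 6, 7, 10, 11] [] [(8, 9)]
      (withNeg [[-11, 4, 7], [-11, 4, 7], [-11, 5, 6], [-10, 4, 6], [-10, 5, 5], [-10, 3, 7],
       [-6, 3, 3]])
      (d := 0) (dvd_zero _) (by decide) (by decide) (t := 12) (by decide) (by omega)
      (by simp) (by decide)

theorem mem_HWP_sixteen {m h : ℕ} (hm : Odd m) (hm3 : 3 ≤ m) (hmn : m ≤ 2 * h + 1)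
    (hh : 10 ≤ h) :
    (16, 2 * h + 1 - 16) ∈ HWP (lexEmpty (SimpleGraph.cycleGraph m) (2 * h + 1)) m (2 * h + 1) := by
  rcases (by omega : h = 10 ∨ h = 11 ∨ 12 ≤ h) with
    rfl | rfl | hh'
  · exact mem_HWP_of_table (w := 3) hm hm3 hmn (by decide) hm3
      (zeroOneTwo_decomposes hm hm3 hmn (by omega)) (by decide) rfl
      [3, 4, 5, 6, 7, 8, 9, 10] [] []
      (withNeg [[-10, 4, 6], [-10, 4, 6], [-7, 3, 4], [5, 7, 9], [5, 7, 9], [-9, 3, 6],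
       [3, 8, 10], [5, 8, 8]])
      (d := 21) (by decide) (by decide) (by decide) (t := 11) (by decide) (by omega)
      (by simp) (by decide)
  · exact mem_HWP_of_table (w := 3) hm hm3 hmn (by decide) hm3
      (zeroOneTwo_decomposes hm hm3 hmn (by omega)) (by decide) rfl
      [3, 4, 5, 6, 7, 8, 9, 10] [11] []
      (withNeg [[-9, 4, 5], [-9, 4, 5], [-8, 3, 5], [7, 8, 8], [4, 9, 10], [-6, 3, 3],
       [6, 7, 10], [6, 7, 10]])
      (d := 23) (by decide) (by decide) (by decide) (t := 12) (by decide) (by omega)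
      (by decide) (by decide)
  · exact mem_HWP_of_table (w := 3) hm hm3 hmn (by decide) hm3
      (zeroTwoFour_decomposes hm hm3 hmn (by omega)) (by decide) rfl
      [1, 3, 5, 6, 7, 8, 9, 12] [] [(10, 11)]
      [[-12, 5, 7], [-12, 5, 7], [-12, 5, 7], [-6, -6, 12], [-7, -5, 12], [-7, -5, 12],
       [-9, 3, 6], [-9, 1, 8], [-9, 1, 8], [-8, -1, 9], [-8, -1, 9], [-8, -1, 9], [-5, -3, 8],
       [-7, 1, 6], [-6, 3, 3], [-3, -3, 6]]
      (d := 0) (dvd_zero _) (by decide) (by decide) (t := 13) (by decide) (by omega)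
      (by simp) (by decide)

theorem mem_HWP_eighteen {m h : ℕ} (hm : Odd m) (hm3 : 3 ≤ m) (hmn : m ≤ 2 * h + 1)
    (hh : 11 ≤ h) :
    (18, 2 * h + 1 - 18) ∈ HWP (lexEmpty (SimpleGraph.cycleGraph m) (2 * h + 1)) m (2 * h + 1) := by
  exact mem_HWP_of_table (w := 3) hm hm3 hmn (by decide) hm3
    (zeroTwoFour_decomposes hm hm3 hmn (by omega)) (by decide) rfl
      [1, 3, 5, 6, 7, 8, 9, 10, 11] [] []
    (withNeg [[-11, 5, 6], [-11, 5, 6], [-11, 5, 6], [-10, 3, 7], [-10, 3, 7], [-10, 3, 7],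
     [-9, 1, 8], [-9, 1, 8], [-9, 1, 8]])
    (d := 0) (dvd_zero _) (by decide) (by decide) (t := 12) (by decide) (by omega)
    (by simp) (by decide)

theorem mem_HWP_twenty {m h : ℕ} (hm : Odd m) (hm3 : 3 ≤ m) (hmn : m ≤ 2 * h + 1)
    (hh : 12 ≤ h) :
    (20, 2 * h + 1 - 20) ∈ HWP (lexEmpty (SimpleGraph.cycleGraph m) (2 * h + 1)) m (2 * h + 1) := by
  exact mem_HWP_of_table (w := 3) hm hm3 hmn (by decide) hm3
    (zeroTwoFour_decomposes hm hm3 hmn (by omega)) (by decide) rfl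
      [1, 3, 5, 6, 7, 8, 9, 10, 11, 12] [] []
    (withNeg [[-12, 5, 7], [-12, 5, 7], [-12, 6, 6], [-11, 3, 8], [-11, 3, 8], [-11, 5, 6],
     [-10, 3, 7], [-10, 1, 9], [-10, 1, 9], [-9, 1, 8]])
    (d := 0) (dvd_zero _) (by decide) (by decide) (t := 13) (by decide) (by omega)
    (by simp) (by decide)

theorem mem_HWP_twentyTwo {m h : ℕ} (hm : Odd m) (hm3 : 3 ≤ m) (hmn : m ≤ 2 * h + 1)
    (hh : 13 ≤ h) :
    (22, 2 * h + 1 - 22) ∈ HWP (lexEmpty (SimpleGraph.cycleGraph m) (2 * h + 1)) m (2 * h + 1) := by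
  exact mem_HWP_of_table (w := 3) hm hm3 hmn (by decide) hm3
    (zeroTwoFour_decomposes hm hm3 hmn (by omega)) (by decide) rfl
      [1, 3, 5, 6, 7, 8, 9, 10, 11, 12, 13] [] []
    [[-13, 3, 10], [-13, 5, 8], [-13, 6, 7], [13, -7, -6], [13, -7, -6], [13, -8, -5],
     [12, -7, -5], [12, -9, -3], [12, -11, -1], [-12, 6, 6], [-12, 5, 7], [-12, 5, 7],
     [-11, 3, 8], [-11, 3, 8], [11, -6, -5], [11, -8, -3], [11, -8, -3], [-10, 1, 9],
     [-10, 1, 9], [-10, 1, 9], [10, -9, -1], [10, -9, -1]]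
    (d := 0) (dvd_zero _) (by decide) (by decide) (t := 14) (by decide) (by omega)
    (by simp) (by decide)

theorem mem_HWP_twentyFour {m h : ℕ} (hm : Odd m) (hm3 : 3 ≤ m) (hmn : m ≤ 2 * h + 1)
    (hh : 14 ≤ h) :
    (24, 2 * h + 1 - 24) ∈ HWP (lexEmpty (SimpleGraph.cycleGraph m) (2 * h + 1)) m (2 * h + 1) := by
  exact mem_HWP_of_table (w := 3) hm hm3 hmn (by decide) hm3
    (zeroTwoFour_decomposes hm hm3 hmn (by omega)) (by decide) rfl
      [1, 3, 5, 6, 7, 8, 9, 10, 11, 12, 13, 14] [] []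
    [[-14, 6, 8], [-14, 6, 8], [-14, 6, 8], [-9, -5, 14], [-9, -5, 14], [-9, -5, 14],
     [-13, 3, 10], [-13, 3, 10], [-13, 3, 10], [-7, -6, 13], [-7, -6, 13], [-7, -6, 13],
     [-12, 5, 7], [-12, 5, 7], [-12, 5, 7], [-11, -1, 12], [-11, -1, 12], [-11, -1, 12],
     [-8, -3, 11], [-8, -3, 11], [-8, -3, 11], [-10, 1, 9], [-10, 1, 9], [-10, 1, 9]]
    (d := 0) (dvd_zero _) (by decide) (by decide) (t := 15) (by decide) (by omega)
    (by simp) (by decide)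

theorem mem_HWP_twentySix {m h : ℕ} (hm : Odd m) (hm3 : 3 ≤ m) (hmn : m ≤ 2 * h + 1)
    (hh : 15 ≤ h) :
    (26, 2 * h + 1 - 26) ∈ HWP (lexEmpty (SimpleGraph.cycleGraph m) (2 * h + 1)) m (2 * h + 1) := by
  exact mem_HWP_of_table (w := 3) hm hm3 hmn (by decide) hm3
    (zeroTwoFour_decomposes hm hm3 hmn (by omega)) (by decide) rfl
      [1, 3, 5, 6, 7, 8, 9, 10, 11, 12, 13, 14, 15] [] []
    (withNeg [[-15, 6, 9], [-15, 6, 9], [-15, 3, 12], [-14, 3, 11], [-14, 7, 7], [-14, 6, 8],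
     [-13, 5, 8], [-13, 5, 8], [-13, 3, 10], [-12, 1, 11], [-12, 5, 7], [-11, 1, 10], [-10, 1, 9]])
    (d := 0) (dvd_zero _) (by decide) (by decide) (t := 16) (by decide) (by omega)
    (by simp) (by decide)

/-! ### Assembling all values of α -/

/-- The interval [-k, k] contains the difference 0, so the C_n side needs no block of five and there
are no exceptions. -/
theorem mem_HWP_of_odd {m h k : ℕ} (hm : Odd m) (hm3 : 3 ≤ m) (hmn : m ≤ 2 * h + 1) (hk : k ≤ h) :
    (2 * k + 1, 2 * h + 1 - (2 * k + 1)) ∈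
      HWP (lexEmpty (SimpleGraph.cycleGraph m) (2 * h + 1)) m (2 * h + 1) := by
  have hS := decomposesInto_magSet_of_cover hm (n := 2 * h + 1) ⟨h, rfl⟩ hm3 (by decide) hm3
    (S := Finset.Icc (-k : ℤ) k) (fun z hz => by rw [Finset.mem_Icc] at *; omega)
    (fun z hz => by rw [Finset.mem_Icc] at hz; omega)
    ((hasZeroSumCover_Icc k).of_dvd (dvd_zero _))
  have hR := decomposesInto_magSet_Icc hm hm3 hmn (h - k) (k + 1) (by omega) (by omega)
  rw [Int.card_Icc] at hS
  convert mem_HWP_of_magSets ⟨h, rfl⟩ hm3 hS hR ?_ ?_ using 2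
  · omega
  · omega
  · rw [Set.disjoint_left]
    simp only [Set.mem_ofPred_eq, Finset.mem_Icc, Set.mem_Icc]
    omega
  · simp only [Set.mem_ofPred_eq, Finset.mem_Icc, Set.mem_Icc]
    omega

theorem mem_HWP_zero {m h : ℕ} (hm : Odd m) (hm3 : 3 ≤ m) (hmn : m ≤ 2 * h + 1) (hh : 2 ≤ h) :
    (0, 2 * h + 1) ∈ HWP (lexEmpty (SimpleGraph.cycleGraph m) (2 * h + 1)) m (2 * h + 1) := by
  have hT := decomposesInto_zero_one_two hm (n := 2 * h + 1) ⟨h, rfl⟩ hm3 hmn (by omega)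
  have hR := decomposesInto_magSet_Icc hm hm3 hmn (h - 2) 3 (by omega) (by omega)
  convert mem_HWP_of_magSets ⟨h, rfl⟩ hm3 (S := ∅)
    (by simpa [magSet] using decomposesInto_empty _ _ _) (hT.magSet_union hR ?_)
    (Set.empty_disjoint _) ?_ using 2
  · omega
  · rw [Set.disjoint_left]
    simp only [Set.mem_insert_iff, Set.mem_singleton_iff, Set.mem_Icc]
    omega
  · simp only [Set.mem_union, Set.mem_insert_iff, Set.mem_singleton_iff, Set.mem_Icc]
    omega

/-- The differences are divided as [-K, K] without the block, the block {0, ±2, ±4}, and everything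
beyond K; the first part has 2K + 1 - 5 elements. -/
theorem mem_HWP_of_large {m h K : ℕ} (hm : Odd m) (hm3 : 3 ≤ m) (hmn : m ≤ 2 * h + 1)
    (hK : 16 ≤ K) (hKh : K ≤ h) :
    (2 * (K - 2), 2 * h + 1 - 2 * (K - 2)) ∈
      HWP (lexEmpty (SimpleGraph.cycleGraph m) (2 * h + 1)) m (2 * h + 1) := by
  have hc : HasZeroSumCover 3 0 (Finset.Icc (-K : ℤ) K \ {0, 2, -2, 4, -4}) := by
    rcases Nat.even_or_odd' K with ⟨M, rfl | rfl⟩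
    · exact_mod_cast hasZeroSumCover_even (M := M) (by omega)
    · exact_mod_cast hasZeroSumCover_odd (M := M) (by omega)
  have hS := decomposesInto_magSet_of_cover hm (n := 2 * h + 1) ⟨h, rfl⟩ hm3 (by decide) hm3
    (S := Finset.Icc (-K : ℤ) K \ {0, 2, -2, 4, -4}) (fun z hz => by
      simp only [Finset.mem_sdiff, Finset.mem_Icc, Finset.mem_insert, Finset.mem_singleton] at *
      omega)
    (fun z hz => by simp only [Finset.mem_sdiff, Finset.mem_Icc] at hz; omega)
    (hc.of_dvd (dvd_zero _))
  have hT := decomposesInto_zero_two_four hm (n := 2 * h + 1) ⟨h, rfl⟩ hm3 hmn (by omega)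
  have hR := decomposesInto_magSet_Icc hm hm3 hmn (h - K) (K + 1) (by omega) (by omega)
  have hsub : ({0, 2, -2, 4, -4} : Finset ℤ) ⊆ Finset.Icc (-K : ℤ) K := by
    intro z hz
    simp only [Finset.mem_insert, Finset.mem_singleton] at hz
    rw [Finset.mem_Icc]
    omega
  rw [Finset.card_sdiff_of_subset hsub, Int.card_Icc,
    show ({0, 2, -2, 4, -4} : Finset ℤ).card = 5 from rfl] at hS
  convert mem_HWP_of_magSets ⟨h, rfl⟩ hm3 hS (hT.magSet_union hR ?_) ?_ ?_ using 2
  · omega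
  · omega
  · rw [Set.disjoint_left]
    simp only [Set.mem_insert_iff, Set.mem_singleton_iff, Set.mem_Icc]
    omega
  · rw [Set.disjoint_left]
    simp only [Set.mem_ofPred_eq, Finset.mem_sdiff, Set.mem_union, Finset.mem_Icc, Set.mem_Icc,
      Finset.mem_insert, Finset.mem_singleton, Set.mem_insert_iff, Set.mem_singleton_iff]
    omega
  · simp only [Set.mem_ofPred_eq, Finset.mem_sdiff, Set.mem_union, Finset.mem_Icc, Set.mem_Icc,
      Finset.mem_insert, Finset.mem_singleton, Set.mem_insert_iff, Set.mem_singleton_iff]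
    omega

theorem mainTheorem2 (m n α β : ℕ) (hm : Odd m) (hn : Odd n) (hm3 : 3 ≤ m) (hmn : m ≤ n)
    (hα : α ≤ n) :
    ((α, β) ∈ HWP (lexEmpty (SimpleGraph.cycleGraph m) n) m n → β = n - α) ∧
    (β = n - α →
      ¬ (α = 2 ∨ α = 4 ∨ β = 1 ∨ β = 3 ∨
          (m, n, α) = (3, 11, 6) ∨ (m, n, α) = (3, 13, 8) ∨ (m, n, α) = (3, 15, 8)) →
      (α, β) ∈ HWP (lexEmpty (SimpleGraph.cycleGraph m) n) m n) := by
  refine ⟨fun h => ?_, ?_⟩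
  · have := eq_sub_of_mem_HWP hm3 (hm3.trans hmn) h
    omega
  rintro rfl hex
  obtain ⟨h, rfl⟩ := hn
  simp only [Prod.mk.injEq] at hex
  rcases Nat.even_or_odd' α with ⟨q, rfl | rfl⟩
  -- Taking K = q + 2 gives α = 2(K - 2), and the threshold K ≥ 16 is the condition M ≥ 8 of the
  -- trade. Excluding β = 1 and β = 3 leaves β ≥ 5 for even α, which is the lower bound on h
  -- required in each case.
  · by_cases hq : 14 ≤ q
    · have := mem_HWP_of_large hm hm3 hmn (K := q + 2) (by omega) (by omega)
      rwa [Nat.add_sub_cancel] at this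
    push Not at hq
    interval_cases q
    · exact mem_HWP_zero hm hm3 hmn (by omega)
    · omega
    · omega
    · exact mem_HWP_six hm hm3 hmn (by omega) (by omega)
    · exact mem_HWP_eight hm hm3 hmn (by omega) (by omega)
    · exact mem_HWP_ten hm hm3 hmn (by omega)
    · exact mem_HWP_twelve hm hm3 hmn (by omega)
    · exact mem_HWP_fourteen hm hm3 hmn (by omega)
    · exact mem_HWP_sixteen hm hm3 hmn (by omega)
    · exact mem_HWP_eighteen hm hm3 hmn (by omega)
    · exact mem_HWP_twenty hm hm3 hmn (by omega)
    · exact mem_HWP_twentyTwo hm hm3 hmn (by omega)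
    · exact mem_HWP_twentyFour hm hm3 hmn (by omega)
    · exact mem_HWP_twentySix hm hm3 hmn (by omega)
  · exact mem_HWP_of_odd hm hm3 hmn (by omega)
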